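/- For a real invertible $d\times d$ matrix $M$ let $\sigma_1(M)\ge\dots\ge\sigma_d(M)$ be its singular values. Let $1\le i<d$. A set $\Sigma\subset GL(d,\mathbb{R})$ is dominated of index $i$ if there are $c>0$ and $0<\tau<1$ such that $\sigma_{i+1}(A_1\cdots A_N)/\sigma_i(A_1\cdots A_N)<c\,\tau^N$ for every finite sequence $A_1,\dots,A_N$ in $\Sigma$. Let $G(i,d)$ be the Grassmannian of $i$-dimensional subspaces of $\mathbb{R}^d$. An unstable multicone of index $i$ for $\Sigma$ is a non-empty set $C\subset G(i,d)$ such that (1) the closure of $\{A\cdot E : A\in\Sigma,\ E\in C\}$ is contained in the interior of $C$; (2) some $(d-i)$-dimensional subspace is transverse to all elements of $C$; (3) $C$ has finitely many connected components, and their closures are pairwise disjoint. A stable multicone of index $i$ for $\Sigma$ is a set $C\subset G(d-i,d)$ that is an unstable multicone of index $d-i$ for $\{A^{-1} : A\in\Sigma\}$. For a set $K$ of linear subspaces of $\mathbb{R}^d$ let $PK\subset P\mathbb{R}^d$ be the set of directions contained in some element of $K$. A subset of $P\mathbb{R}^d$ is semiconvex if its intersection with every projective line is connected (possibly empty). A multicone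 $C$ is locally semiconvex if $PK$ is semiconvex for every connected component $K$ of $C$. Theorem. There is a continuous map $A\colon[0,1]\to GL(4,\mathbb{R})$ such that the set $\mathrm{Im}(A)$ is dominated of index $2$ and such that $\mathrm{Im}(A)$ has no locally semiconvex unstable multicone of index $2$ and no locally semiconvex stable multicone of index $2$. Moreover, these properties persist under $C^0$-perturbations of $A$: there is a neighbourhood $\mathcal{U}$ of $A$ in the space of continuous maps $[0,1]\to GL(4,\mathbb{R})$, with the topology of uniform convergence, such that for every $B\in\mathcal{U}$ the set $\mathrm{Im}(B)$ is dominated of index $2$ and has no locally semiconvex unstable or stable multicone of index $2$. -/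

import Mathlib

open scoped Topology Pointwise

noncomputable section

/-- The space `ℝ^d` with its Euclidean inner product. -/
abbrev RVec (d : ℕ) : Type := EuclideanSpace ℝ (Fin d)

/-- The `i`-th singular value (`i = 1, …, d`, in decreasing order) of an invertible matrix.
Mathlib numbers the singular values from `0`. -/
def sigmaVal {d : ℕ} (i : ℕ) (M : GL (Fin d) ℝ) : ℝ :=
  (Matrix.toEuclideanLin (M : Matrix (Fin d) (Fin d) ℝ)).singularValues (i - 1)

/-- A set `S` of invertible matrices is dominated of index `i` (for `1 ≤ i < d`): the ratio of the
`(i+1)`-st to the `i`-th singular value of the products of `N` elements of `S` is smaller than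
`c * τ ^ N`, for some constants `c > 0` and `0 < τ < 1`. -/
def DominatedOfIndex {d : ℕ} (i : ℕ) (S : Set (GL (Fin d) ℝ)) : Prop :=
  ∃ c τ : ℝ, 0 < c ∧ 0 < τ ∧ τ < 1 ∧ ∀ l : List (GL (Fin d) ℝ), (∀ M ∈ l, M ∈ S) →
    sigmaVal (i + 1) l.prod / sigmaVal i l.prod < c * τ ^ l.length

/-- The Grassmannian `G(i,d)` of `i`-planes in `ℝ^d`. The projective space is `G(1,d)`. -/
def Grass (i d : ℕ) : Type := {E : Submodule ℝ (RVec d) // Module.finrank ℝ E = i}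

/-- The linearly independent `i`-tuples of vectors of `ℝ^d`, as a subspace of `(ℝ^d)^i`. -/
abbrev Frames (i d : ℕ) : Type := {v : Fin i → RVec d // LinearIndependent ℝ v}

/-- The `i`-plane spanned by a linearly independent `i`-tuple. -/
def spanFrame {i d : ℕ} (v : Frames i d) : Grass i d :=
  ⟨Submodule.span ℝ (Set.range v.1), by
    rw [finrank_span_eq_card v.2, Fintype.card_fin]⟩

/-- The usual topology of the Grassmannian: the quotient topology under the map that sends a
linearly independent tuple to its span. -/
instance (i d : ℕ) : TopologicalSpace (Grass i d) :=
  TopologicalSpace.coinduced spanFrame inferInstance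

/-- A matrix in `GL(d,ℝ)` as a linear automorphism of `ℝ^d`. -/
def glEquiv {d : ℕ} (M : GL (Fin d) ℝ) : RVec d ≃ₗ[ℝ] RVec d :=
  LinearEquiv.ofLinearMap (Matrix.toEuclideanLin (M : Matrix (Fin d) (Fin d) ℝ))
    (Matrix.toEuclideanLin ((M⁻¹ : GL (Fin d) ℝ) : Matrix (Fin d) (Fin d) ℝ))
    (by
      ext x
      simp [Matrix.toLpLin_apply, Matrix.mulVec_mulVec, ← Units.val_mul, -Matrix.coe_units_inv])
    (by
      ext x
      simp [Matrix.toLpLin_apply, Matrix.mulVec_mulVec, ← Units.val_mul, -Matrix.coe_units_inv])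

/-- The natural action of `GL(d,ℝ)` on `G(i,d)`: the image `M · E` of the plane `E` under `M`. -/
def glMap {i d : ℕ} (M : GL (Fin d) ℝ) (E : Grass i d) : Grass i d :=
  ⟨E.1.map (glEquiv M : RVec d →ₗ[ℝ] RVec d), by
    rw [LinearEquiv.finrank_map_eq (glEquiv M) E.1]; exact E.2⟩

/-- The set of all `M · E` with `M ∈ S` and `E ∈ C`. -/
def imageSet {i d : ℕ} (S : Set (GL (Fin d) ℝ)) (C : Set (Grass i d)) : Set (Grass i d) :=
  {E' | ∃ M ∈ S, ∃ E ∈ C, E' = glMap M E}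

/-- `C` is strictly invariant by `S`. -/
def StrictlyInvariant {i d : ℕ} (S : Set (GL (Fin d) ℝ)) (C : Set (Grass i d)) : Prop :=
  closure (imageSet S C) ⊆ interior C

/-- The set of connected components of a subset of a topological space. -/
def componentsOf {X : Type} [TopologicalSpace X] (C : Set X) : Set (Set X) :=
  {K | ∃ x ∈ C, K = connectedComponentIn C x}

/-- `C ⊆ G(i,d)` is an unstable multicone of index `i` for `S`. -/
structure IsUnstableMulticone {i d : ℕ} (S : Set (GL (Fin d) ℝ)) (C : Set (Grass i d)) :
    Prop where
  nonempty : C.Nonempty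
  strictlyInvariant : StrictlyInvariant S C
  exists_transverse : ∃ F : Grass (d - i) d, ∀ E ∈ C, IsCompl E.1 F.1
  finite_components : (componentsOf C).Finite
  disjoint_closures : (componentsOf C).PairwiseDisjoint closure

/-- `C ⊆ G(d-i,d)` is a stable multicone of index `i` for `S`: an unstable multicone (of
index `d - i`) for the set of the inverses of the elements of `S`. -/
def IsStableMulticone (i : ℕ) {d : ℕ} (S : Set (GL (Fin d) ℝ)) (C : Set (Grass (d - i) d)) :
    Prop :=
  IsUnstableMulticone S⁻¹ C

/-- `PC`: the set of directions that are contained in some element of `C`. -/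
def directions {i d : ℕ} (C : Set (Grass i d)) : Set (Grass 1 d) :=
  {L | ∃ E ∈ C, L.1 ≤ E.1}

/-- The projective line formed by the directions contained in a `2`-plane `P`. -/
def projLine {d : ℕ} (P : Grass 2 d) : Set (Grass 1 d) :=
  {L | L.1 ≤ P.1}

/-- A subset of the projective space is semiconvex if its intersection with every projective line
is connected (an empty intersection is allowed). -/
def Semiconvex {d : ℕ} (C : Set (Grass 1 d)) : Prop :=
  ∀ P : Grass 2 d, IsPreconnected (projLine P ∩ C)

/-- `C ⊆ G(i,d)` is locally semiconvex if the set of directions of each of its connected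
components is semiconvex. -/
def LocallySemiconvex {i d : ℕ} (C : Set (Grass i d)) : Prop :=
  ∀ K ∈ componentsOf C, Semiconvex (directions K)

/-- `S` is dominated of index `i`. Moreover, no unstable multicone and no stable multicone of
index `i` for `S` is locally semiconvex. -/
def DominatedNoSemiconvexMulticone {d : ℕ} (i : ℕ) (S : Set (GL (Fin d) ℝ)) : Prop :=
  DominatedOfIndex i S ∧
    (¬ ∃ C : Set (Grass i d), IsUnstableMulticone S C ∧ LocallySemiconvex C) ∧
    (¬ ∃ C : Set (Grass (d - i) d), IsStableMulticone i S C ∧ LocallySemiconvex C)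

end

noncomputable section

open Filter

/-! ### The action of the linear group on vectors and planes -/

section GeneralLinearAction

variable {d : ℕ}

/-! The path is A_t = g_t D g_t⁻¹, with D = diag(l, l, 1/l, 1/l), l large and g_t = `frameMat t`.
Thus A_t expands the plane E_t of the first two columns of g_t and contracts the plane F_t of the
last two. E_t is the graph of the rotation R_t of angle πt; F_t consists of the points (T_t y, y),
where T_t has rows (2t, -b), (b, 3t) and b = 2t(1-t). Since det(1 - T_s R_t) > 0 for all s, t
(`transversality_det_pos`), every E_t is transverse to every F_s. For large l a narrow cone around
the planes E_t is therefore invariant and expanded, and so is a cone around the planes F_t for the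
inverses (`expandsCone_approxCone`). Domination follows by min-max.

Obstruction (`not_locallySemiconvex_of_crossing`). Let C be an unstable multicone. Iterating A_0 on
an element of C gives E_0 ∈ C. The curve t ↦ A_t^n E_0 stays in C and joins E_0 to A_1^n E_0, which
tends to E_1, so E_0 and E_1 lie in one component K. No element of C meets F_0 or F_1 outside 0. But
E_0 = {(x, x)}, E_1 = {(x, -x)}, F_0 = {(0, y)} and F_1 = {(2y₁, 3y₂, y₁, y₂)}: in the plane of the
second and fourth axes they have slopes 1, -1, ∞, 1/3, in alternating order. Hence PK is
disconnected on this projective line. Passing to inverses exchanges the roles of E and F and keeps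
the alternation, which settles stable multicones.

Persistence. The cone conditions survive a small perturbation B, and the invariant planes of B_0 and
B_1 stay close to the original ones (`exists_block_diagonalization`). A line meeting the four planes
corresponds to a root μ of a determinant (`exists_crossing_of_det_eq_zero`). Because 2 ≠ 3 the roots
for A are simple, so a change of sign, and with it a negative root, survives. -/

theorem glEquiv_mul_apply (M N : GL (Fin d) ℝ) (v : RVec d) :
    glEquiv (M * N) v = glEquiv M (glEquiv N v) := by
  simp [glEquiv]

theorem glEquiv_one_apply (v : RVec d) : glEquiv (1 : GL (Fin d) ℝ) v = v := by
  simp [glEquiv]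

theorem glEquiv_inv_apply_self (M : GL (Fin d) ℝ) (v : RVec d) :
    glEquiv M⁻¹ (glEquiv M v) = v := by
  rw [← glEquiv_mul_apply, inv_mul_cancel, glEquiv_one_apply]

theorem glEquiv_apply_inv_self (M : GL (Fin d) ℝ) (v : RVec d) :
    glEquiv M (glEquiv M⁻¹ v) = v := by
  rw [← glEquiv_mul_apply, mul_inv_cancel, glEquiv_one_apply]

theorem glEquiv_apply_eq (M : GL (Fin d) ℝ) (v : RVec d) :
    glEquiv M v = WithLp.toLp 2 ((M : Matrix (Fin d) (Fin d) ℝ).mulVec v.ofLp) := rfl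

theorem continuous_glEquiv_apply {X : Type*} [TopologicalSpace X] {B : X → GL (Fin d) ℝ}
    (hB : Continuous B) (v : RVec d) : Continuous fun t => glEquiv (B t) v := by
  simp only [glEquiv_apply_eq]
  refine (PiLp.continuous_toLp 2 _).comp ?_
  exact (Units.continuous_val.comp hB).matrix_mulVec continuous_const

theorem mem_glMap {i : ℕ} (M : GL (Fin d) ℝ) (E : Grass i d) (v : RVec d) :
    v ∈ (glMap M E).1 ↔ glEquiv M⁻¹ v ∈ E.1 := by
  constructor
  · rintro ⟨w, hw, rfl⟩
    have := glEquiv_inv_apply_self M w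
    simpa [this] using hw
  · intro h
    exact ⟨_, h, glEquiv_apply_inv_self M v⟩

theorem apply_mem_glMap {i : ℕ} (M : GL (Fin d) ℝ) {E : Grass i d} {v : RVec d} (hv : v ∈ E.1) :
    glEquiv M v ∈ (glMap M E).1 := ⟨v, hv, rfl⟩

theorem glMap_mul {i : ℕ} (M N : GL (Fin d) ℝ) (E : Grass i d) :
    glMap (M * N) E = glMap M (glMap N E) := by
  apply Subtype.ext
  ext v
  rw [mem_glMap, mem_glMap, mem_glMap, mul_inv_rev, glEquiv_mul_apply]

theorem glMap_one {i : ℕ} (E : Grass i d) : glMap (1 : GL (Fin d) ℝ) E = E := by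
  apply Subtype.ext
  ext v
  rw [mem_glMap, inv_one, glEquiv_one_apply]

theorem glMap_inv_eq {i : ℕ} {M : GL (Fin d) ℝ} {E : Grass i d} (h : glMap M E = E) :
    glMap M⁻¹ E = E := by
  conv_lhs => rw [← h]
  rw [← glMap_mul, inv_mul_cancel, glMap_one]

theorem glMap_pow_eq {i : ℕ} {M : GL (Fin d) ℝ} {E : Grass i d} (h : glMap M E = E) (n : ℕ) :
    glMap (M ^ n) E = E := by
  induction n with
  | zero => rw [pow_zero, glMap_one]
  | succ n ih => rw [pow_succ, glMap_mul, h, ih]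

end GeneralLinearAction

/-! ### Topology of the Grassmannian through frames -/

section GrassmannianTopology

variable {i d : ℕ}

theorem continuous_spanFrame : Continuous (spanFrame : Frames i d → Grass i d) :=
  continuous_coinduced_rng

theorem exists_spanFrame_eq (E : Grass i d) : ∃ u : Frames i d, spanFrame u = E := by
  let b := Module.finBasisOfFinrankEq ℝ E.1 E.2
  refine ⟨⟨fun j => (b j : RVec d), ?_⟩, ?_⟩
  · exact b.linearIndependent.map' E.1.subtype E.1.ker_subtype
  · apply Subtype.ext
    have : (Set.range fun j => (b j : RVec d)) = E.1.subtype '' Set.range b := by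
      rw [← Set.range_comp]; rfl
    change Submodule.span ℝ (Set.range fun j => (b j : RVec d)) = E.1
    rw [this, Submodule.span_image, b.span_eq, Submodule.map_top, Submodule.range_subtype]

theorem mem_spanFrame (u : Frames i d) (j : Fin i) : u.1 j ∈ (spanFrame u).1 :=
  Submodule.subset_span ⟨j, rfl⟩

theorem eq_spanFrame_of_forall_mem {u : Frames i d} {G : Grass i d} (h : ∀ j, u.1 j ∈ G.1) :
    G = spanFrame u := by
  apply Subtype.ext
  refine (Submodule.eq_of_le_of_finrank_eq ?_ ?_).symm
  · exact Submodule.span_le.2 (by rintro _ ⟨j, rfl⟩; exact h j)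
  · rw [(spanFrame u).2, G.2]

theorem isOpen_frames : IsOpen {v : Fin i → RVec d | LinearIndependent ℝ v} :=
  isOpen_setOfPred_linearIndependent

/-- Independence is an open condition, so openness in the quotient can be tested on arbitrary tuples
near a frame. -/
theorem eventually_mem_of_isOpen {O : Set (Grass i d)} (hO : IsOpen O) {u : Frames i d}
    (hu : spanFrame u ∈ O) :
    ∀ᶠ v in 𝓝 u.1, ∃ h : LinearIndependent ℝ v, spanFrame ⟨v, h⟩ ∈ O := by
  have h1 : IsOpen (Subtype.val '' (spanFrame ⁻¹' O : Set (Frames i d))) :=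
    isOpen_frames.isOpenMap_subtype_val _ (hO.preimage continuous_spanFrame)
  filter_upwards [h1.mem_nhds ⟨u, hu, rfl⟩]
  rintro _ ⟨w, hw, rfl⟩
  exact ⟨w.2, hw⟩

/-- A sequence of planes that contain vectors approaching every vector of `E` converges to `E`. -/
theorem eventually_mem_of_approx {E : Grass i d} {G : ℕ → Grass i d}
    (h : ∀ u ∈ E.1, ∃ e : ℕ → RVec d, (∀ n, e n ∈ (G n).1) ∧ Tendsto e atTop (𝓝 u))
    {O : Set (Grass i d)} (hO : IsOpen O) (hE : E ∈ O) : ∀ᶠ n in atTop, G n ∈ O := by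
  obtain ⟨u, rfl⟩ := exists_spanFrame_eq E
  choose e he ht using fun j => h (u.1 j) (mem_spanFrame u j)
  have ht' : Tendsto (fun n j => e j n) atTop (𝓝 u.1) := tendsto_pi_nhds.2 ht
  filter_upwards [ht'.eventually (eventually_mem_of_isOpen hO hE)]
  rintro n ⟨h1, h2⟩
  rwa [eq_spanFrame_of_forall_mem (u := ⟨_, h1⟩) (G := G n) fun j => he j n]

theorem continuous_glMap_apply {X : Type*} [TopologicalSpace X] {B : X → GL (Fin d) ℝ}
    (hB : Continuous B) (E : Grass i d) : Continuous fun t => glMap (B t) E := by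
  obtain ⟨u, rfl⟩ := exists_spanFrame_eq E
  have key : ∀ t, glMap (B t) (spanFrame u) =
      spanFrame ⟨fun j => glEquiv (B t) (u.1 j),
        u.2.map' _ (LinearEquiv.ker (glEquiv (B t)))⟩ := fun t =>
    eq_spanFrame_of_forall_mem fun j => apply_mem_glMap _ (mem_spanFrame u j)
  simp only [key]
  refine continuous_spanFrame.comp (Continuous.subtype_mk ?_ _)
  exact continuous_pi fun j => continuous_glEquiv_apply hB _

/-- A non-empty open set of planes contains a plane transverse to a given subspace. -/
theorem exists_mem_isCompl {O : Set (Grass i d)} (hO : IsOpen O) (hne : O.Nonempty)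
    {E : Grass i d} {F : Submodule ℝ (RVec d)} (hEF : IsCompl E.1 F) :
    ∃ G ∈ O, IsCompl F G.1 := by
  obtain ⟨G₀, hG₀⟩ := hne
  obtain ⟨v, rfl⟩ := exists_spanFrame_eq G₀
  let b := Module.finBasisOfFinrankEq ℝ E.1 E.2
  let π := E.1.projectionOnto F hEF
  -- Projected to E along F, the frame v + εb becomes T + ε in the basis b. It remains independent
  -- unless -ε is one of the finitely many eigenvalues of T.
  let T : Module.End ℝ E.1 := b.constr ℝ fun j => π (v.1 j)
  have hcont : Tendsto (fun ε : ℝ => fun j => v.1 j + ε • (b j : RVec d)) (𝓝 0) (𝓝 v.1) := by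
    have : Continuous (fun ε : ℝ => fun j => v.1 j + ε • (b j : RVec d)) := by fun_prop
    simpa using this.tendsto 0
  have hev := hcont.eventually (eventually_mem_of_isOpen hO hG₀)
  have hfin : {ε : ℝ | T.HasEigenvalue (-ε)}.Finite := by
    have := T.finite_hasEigenvalue.preimage (f := fun ε : ℝ => -ε) neg_injective.injOn
    exact this
  obtain ⟨ε, ⟨hLI, hmem⟩, hε⟩ := ((infinite_of_mem_nhds (0 : ℝ) hev).sdiff hfin).nonempty
  have hinj : LinearMap.ker (T + ε • 1) = ⊥ := by
    by_contra hne
    apply hε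
    obtain ⟨x, hx, hx0⟩ := Submodule.exists_mem_ne_zero_of_ne_bot hne
    refine Module.End.hasEigenvalue_of_hasEigenvector (x := x) ⟨?_, hx0⟩
    rw [Module.End.mem_eigenspace_iff]
    have : T x + ε • x = 0 := by simpa using hx
    rw [neg_smul]
    exact eq_neg_of_add_eq_zero_left this
  have hπ : LinearIndependent ℝ fun j => π (v.1 j + ε • (b j : RVec d)) := by
    have h1 := b.linearIndependent.map' _ hinj
    convert! h1 using 1
    ext1 j
    simp [T, π]
  refine ⟨_, hmem, ?_⟩
  rw [Submodule.isCompl_iff_disjoint]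
  · rw [Submodule.disjoint_def]
    intro x hxF hxG
    have hx : x ∈ Submodule.span ℝ (Set.range fun j => v.1 j + ε • (b j : RVec d)) := hxG
    obtain ⟨c, rfl⟩ := (Submodule.mem_span_range_iff_exists_fun ℝ).1 hx
    have h0 : π (∑ j, c j • (v.1 j + ε • (b j : RVec d))) = 0 :=
      (Submodule.projectionOnto_apply_eq_zero_iff hEF).2 hxF
    rw [map_sum] at h0
    simp only [map_smul] at h0
    have := Fintype.linearIndependent_iff.1 hπ c h0
    simp [this]
  · rw [(spanFrame ⟨_, hLI⟩).2, ← Submodule.finrank_add_eq_of_isCompl hEF, E.2, add_comm]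

end GrassmannianTopology

/-! ### Hyperbolic splittings and convergence of iterates -/

section Splitting

variable {i j d : ℕ}

/-- The planes `E` and `F` are invariant by `M`, which expands `E` and contracts `F` by a factor of
at least `2`. -/
structure IsHyperbolicSplitting (M : GL (Fin d) ℝ) (E : Grass i d) (F : Grass j d) : Prop where
  glMap_left : glMap M E = E
  glMap_right : glMap M F = F
  expands : ∀ v ∈ E.1, 2 * ‖v‖ ≤ ‖glEquiv M v‖
  contracts : ∀ v ∈ F.1, 2 * ‖v‖ ≤ ‖glEquiv M⁻¹ v‖

namespace IsHyperbolicSplitting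

variable {M : GL (Fin d) ℝ} {E : Grass i d} {F : Grass j d}

theorem inv (h : IsHyperbolicSplitting M E F) : IsHyperbolicSplitting M⁻¹ F E where
  glMap_left := glMap_inv_eq h.glMap_right
  glMap_right := glMap_inv_eq h.glMap_left
  expands := h.contracts
  contracts := by simpa using h.expands

theorem apply_mem_right (h : IsHyperbolicSplitting M E F) {v : RVec d} (hv : v ∈ F.1) :
    glEquiv M v ∈ F.1 := by
  have := apply_mem_glMap M hv
  rwa [h.glMap_right] at this

theorem norm_pow_le (h : IsHyperbolicSplitting M E F) (n : ℕ) {v : RVec d} (hv : v ∈ F.1) :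
    ‖glEquiv (M ^ n) v‖ ≤ (1 / 2) ^ n * ‖v‖ := by
  induction n generalizing v with
  | zero => simp [glEquiv_one_apply]
  | succ n ih =>
    rw [pow_succ, glEquiv_mul_apply]
    have h1 := ih (h.apply_mem_right hv)
    have h2 := h.contracts _ (h.apply_mem_right hv)
    rw [glEquiv_inv_apply_self] at h2
    calc _ ≤ (1 / 2 : ℝ) ^ n * ‖glEquiv M v‖ := h1
      _ ≤ (1 / 2 : ℝ) ^ n * (1 / 2 * ‖v‖) := by gcongr; linarith
      _ = _ := by ring

/-- Under the iterates of `M`, a plane transverse to `F` accumulates at every vector of `E`. -/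
theorem exists_approx (h : IsHyperbolicSplitting M E F) {G : Submodule ℝ (RVec d)}
    (hG : IsCompl F.1 G) {u : RVec d} (hu : u ∈ E.1) :
    ∃ e : ℕ → RVec d, (∀ n, e n ∈ G) ∧ Tendsto (fun n => glEquiv (M ^ n) (e n)) atTop (𝓝 u) := by
  let π := F.1.projectionOnto G hG
  -- Pull u back by M^n inside E and subtract the component in F along G. The subtracted term tends
  -- to 0, and M^n only shrinks it further.
  let x : ℕ → RVec d := fun n => glEquiv (M⁻¹ ^ n) u
  have hx : Tendsto x atTop (𝓝 0) := by
    rw [tendsto_zero_iff_norm_tendsto_zero]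
    refine squeeze_zero (fun n => norm_nonneg _) (fun n => h.inv.norm_pow_le n hu) ?_
    have := (tendsto_pow_atTop_nhds_zero_of_lt_one (r := (1 / 2 : ℝ)) (by norm_num)
      (by norm_num)).mul_const ‖u‖
    simpa using this
  have hπ : Tendsto (fun n => (π (x n) : RVec d)) atTop (𝓝 0) := by
    have h1 : Continuous (F.1.subtype ∘ₗ π) := LinearMap.continuous_of_finiteDimensional _
    have h2 := (h1.tendsto 0).comp hx
    rw [map_zero] at h2
    exact h2
  refine ⟨fun n => x n - π (x n), fun n => ?_, ?_⟩
  · rw [← Submodule.projectionOnto_apply_eq_zero_iff hG, map_sub,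
      Submodule.projectionOnto_apply_left, sub_self]
  · have h1 : ∀ n, glEquiv (M ^ n) (x n - π (x n)) = u - glEquiv (M ^ n) (π (x n)) := by
      intro n
      rw [map_sub, ← glEquiv_mul_apply, inv_pow, mul_inv_cancel, glEquiv_one_apply]
    simp only [h1]
    have h2 : Tendsto (fun n => glEquiv (M ^ n) (π (x n) : RVec d)) atTop (𝓝 0) := by
      rw [tendsto_zero_iff_norm_tendsto_zero] at hπ ⊢
      refine squeeze_zero (fun n => norm_nonneg _) (fun n => ?_) hπ
      refine (h.norm_pow_le n (π (x n)).2).trans ?_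
      exact mul_le_of_le_one_left (norm_nonneg _) (pow_le_one₀ (by norm_num) (by norm_num))
    simpa using tendsto_const_nhds.sub h2

theorem eventually_glMap_pow_mem (h : IsHyperbolicSplitting M E F) {G : Grass i d}
    (hG : IsCompl F.1 G.1) {O : Set (Grass i d)} (hO : IsOpen O) (hE : E ∈ O) :
    ∀ᶠ n in atTop, glMap (M ^ n) G ∈ O := by
  refine eventually_mem_of_approx (fun u hu => ?_) hO hE
  obtain ⟨e, he, ht⟩ := h.exists_approx hG hu
  exact ⟨_, fun n => apply_mem_glMap _ (he n), ht⟩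

end IsHyperbolicSplitting

end Splitting

/-! ### Invariant planes and multicones -/

section Multicone

variable {i j d : ℕ} {S : Set (GL (Fin d) ℝ)} {C : Set (Grass i d)}

namespace IsUnstableMulticone

theorem glMap_mem_interior (hC : IsUnstableMulticone S C) {M : GL (Fin d) ℝ} (hM : M ∈ S)
    {E : Grass i d} (hE : E ∈ C) : glMap M E ∈ interior C :=
  hC.strictlyInvariant (subset_closure ⟨M, hM, E, hE, rfl⟩)

theorem glMap_pow_mem (hC : IsUnstableMulticone S C) {M : GL (Fin d) ℝ} (hM : M ∈ S)
    {E : Grass i d} (hE : E ∈ C) (n : ℕ) : glMap (M ^ n) E ∈ C := by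
  induction n with
  | zero => rwa [pow_zero, glMap_one]
  | succ n ih =>
    rw [pow_succ', glMap_mul]
    exact interior_subset (hC.glMap_mem_interior hM ih)

theorem interior_nonempty (hC : IsUnstableMulticone S C) {M : GL (Fin d) ℝ} (hM : M ∈ S) :
    (interior C).Nonempty :=
  hC.nonempty.imp' (glMap M) fun _ hE => hC.glMap_mem_interior hM hE

/-- The expanded plane belongs to every multicone that has an element transverse to the
contracted plane. -/
theorem left_mem_interior (hC : IsUnstableMulticone S C) {M : GL (Fin d) ℝ} (hM : M ∈ S)
    {E : Grass i d} {F : Grass j d} (h : IsHyperbolicSplitting M E F) {G : Grass i d}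
    (hG : G ∈ C) (hFG : IsCompl F.1 G.1) : E ∈ interior C := by
  refine hC.strictlyInvariant (mem_closure_iff.2 fun O hO hE => ?_)
  obtain ⟨N, hN⟩ := eventually_atTop.1 (h.eventually_glMap_pow_mem hFG hO hE)
  -- One extra iterate exhibits the plane as the image under M of an element of C.
  refine ⟨_, hN (N + 1) (Nat.le_succ N), M, hM, glMap (M ^ N) G, hC.glMap_pow_mem hM hG N, ?_⟩
  rw [pow_succ', glMap_mul]

/-- The contracted plane is transverse to all elements of a multicone. -/
theorem disjoint_right (hC : IsUnstableMulticone S C) {M : GL (Fin d) ℝ} (hM : M ∈ S)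
    {E : Grass i d} {F : Grass j d} (h : IsHyperbolicSplitting M E F) (hE : E ∈ C)
    {G : Grass i d} (hG : G ∈ C) : Disjoint G.1 F.1 := by
  obtain ⟨W, hW⟩ := hC.exists_transverse
  -- W is transverse to E, so M⁻ⁿW accumulates at every f in F. If f ≠ 0 lay in G, a small
  -- perturbation of G inside C would contain a non-zero vector of M⁻ⁿW; its image under M^n would
  -- be an element of C meeting W outside 0.
  have key : ∀ G ∈ interior C, ∀ f ∈ G.1, f ∈ F.1 → f = 0 := by
    intro G hG f hfG hfF
    by_contra hf0
    obtain ⟨e, heW, het⟩ := h.inv.exists_approx (hW E hE) hfF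
    obtain ⟨u, rfl⟩ := exists_spanFrame_eq G
    obtain ⟨c, hc⟩ := (Submodule.mem_span_range_iff_exists_fun ℝ).1
      (show f ∈ Submodule.span ℝ (Set.range u.1) from hfG)
    have hff : inner ℝ f f ≠ (0 : ℝ) := inner_self_ne_zero.2 hf0
    let ℓ : RVec d → ℝ := fun x => inner ℝ f x / inner ℝ f f
    -- Since ℓ f = 1, the combination with coefficients c that gives f for the frame u gives y for
    -- the frame w y.
    let w : RVec d → Fin i → RVec d := fun y k => u.1 k + ℓ (u.1 k) • (y - f)
    have hw : ∀ y, ∑ k, c k • w y k = y := by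
      intro y
      have h1 : ∑ k, c k * ℓ (u.1 k) = 1 := by
        have : ∑ k, c k * ℓ (u.1 k) = inner ℝ f (∑ k, c k • u.1 k) / inner ℝ f f := by
          rw [inner_sum, Finset.sum_div]
          refine Finset.sum_congr rfl fun k _ => ?_
          rw [inner_smul_right, mul_div_assoc]
        rw [this, hc, div_self hff]
      simp only [w, smul_add, smul_smul, Finset.sum_add_distrib, ← Finset.sum_smul]
      rw [hc, h1, one_smul]
      abel
    have hwt : Tendsto w (𝓝 f) (𝓝 u.1) := by
      have : Continuous w := by fun_prop
      have h2 := this.tendsto f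
      have h3 : w f = u.1 := by
        funext k
        simp [w]
      rwa [h3] at h2
    have hev := (hwt.comp het).eventually (eventually_mem_of_isOpen isOpen_interior hG)
    have hne : ∀ᶠ n in atTop, glEquiv (M⁻¹ ^ n) (e n) ≠ 0 := het.eventually_ne hf0
    obtain ⟨n, ⟨hLI, hmem⟩, hn0⟩ := (hev.and hne).exists
    have hyG : glEquiv (M⁻¹ ^ n) (e n) ∈ (spanFrame ⟨_, hLI⟩).1 := by
      rw [← hw (glEquiv (M⁻¹ ^ n) (e n))]
      exact Submodule.sum_mem _ fun k _ => Submodule.smul_mem _ _ (mem_spanFrame ⟨_, hLI⟩ k)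
    have h1 := apply_mem_glMap (M ^ n) hyG
    rw [inv_pow, glEquiv_apply_inv_self] at h1
    have h2 := hC.glMap_pow_mem hM (interior_subset hmem) n
    have h3 := (Submodule.disjoint_def.1 (hW _ h2).disjoint) _ h1 (heW n)
    exact hn0 (by rw [h3, map_zero])
  rw [Submodule.disjoint_def]
  -- An arbitrary element of C reduces to the interior by one application of M, which preserves F.
  intro f hfG hfF
  have := key _ (hC.glMap_mem_interior hM hG) _ (apply_mem_glMap M hfG) (h.apply_mem_right hfF)
  simpa using this

end IsUnstableMulticone

end Multicone

/-! ### Separation on a projective line -/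

section ProjectiveLine

variable {d : ℕ}

/-- By homogeneity the sign of q at a spanning vector decides the condition for the whole line. -/
theorem isOpen_setOf_exists_pos {q : RVec d → ℝ} (hq : Continuous q)
    (hsmul : ∀ (c : ℝ) (x : RVec d), q (c • x) = c ^ 2 * q x) :
    IsOpen {L : Grass 1 d | ∃ x ∈ L.1, 0 < q x} := by
  refine isOpen_coinduced.2 ?_
  have : (spanFrame ⁻¹' {L : Grass 1 d | ∃ x ∈ L.1, 0 < q x} : Set (Frames 1 d)) =
      {v | 0 < q (v.1 0)} := by
    ext v
    constructor
    · rintro ⟨x, hx, hpos⟩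
      have hx' : x ∈ Submodule.span ℝ (Set.range v.1) := hx
      obtain ⟨c, rfl⟩ := (Submodule.mem_span_range_iff_exists_fun ℝ).1 hx'
      rw [Fin.sum_univ_one, hsmul] at hpos
      exact pos_of_mul_pos_right hpos (sq_nonneg _)
    · exact fun h => ⟨_, mem_spanFrame v 0, h⟩
  rw [this]
  exact isOpen_lt continuous_const
    (hq.comp ((continuous_apply 0).comp continuous_subtype_val))

/-- Two directions of a semiconvex set cannot be separated, on a projective line, by two directions
outside of the set. -/
theorem Semiconvex.not_separated {D : Set (Grass 1 d)} (hD : Semiconvex D) {a b : RVec d}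
    (hab : LinearIndependent ℝ ![a, b]) {μ : ℝ} (hμ : μ < 0)
    (ha : ∃ L ∈ D, a ∈ L.1) (hb : ∃ L ∈ D, b ∈ L.1)
    (h₁ : ∀ L ∈ D, a + b ∉ L.1) (h₂ : ∀ L ∈ D, a + μ • b ∉ L.1) : False := by
  let P : Grass 2 d := spanFrame ⟨![a, b], hab⟩
  have haP : a ∈ P.1 := mem_spanFrame (⟨![a, b], hab⟩ : Frames 2 d) 0
  have hbP : b ∈ P.1 := mem_spanFrame (⟨![a, b], hab⟩ : Frames 2 d) 1
  let e : Module.Basis (Fin 2) ℝ P.1 := Module.Basis.span hab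
  have hea : (e 0 : RVec d) = a := congrArg Subtype.val (Module.Basis.span_apply hab 0)
  have heb : (e 1 : RVec d) = b := congrArg Subtype.val (Module.Basis.span_apply hab 1)
  obtain ⟨W, hW⟩ := Submodule.exists_isCompl P.1
  let π := P.1.projectionOnto W hW
  let α : RVec d →ₗ[ℝ] ℝ := e.coord 0 ∘ₗ π
  let β : RVec d →ₗ[ℝ] ℝ := e.coord 1 ∘ₗ π
  have hα : Continuous α := α.continuous_of_finiteDimensional
  have hβ : Continuous β := β.continuous_of_finiteDimensional
  have hπa : π a = e 0 := by
    have := Submodule.projectionOnto_apply_left hW ⟨a, haP⟩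
    rw [show e 0 = ⟨a, haP⟩ from Subtype.ext hea]; exact this
  have hπb : π b = e 1 := by
    have := Submodule.projectionOnto_apply_left hW ⟨b, hbP⟩
    rw [show e 1 = ⟨b, hbP⟩ from Subtype.ext heb]; exact this
  have hαa : α a = 1 := by simp [α, hπa]
  have hαb : α b = 0 := by simp [α, hπb]
  have hβa : β a = 0 := by simp [β, hπa]
  have hβb : β b = 1 := by simp [β, hπb]
  have hrep : ∀ x ∈ P.1, x = α x • a + β x • b := by
    intro x hx
    obtain ⟨c, rfl⟩ := (Submodule.mem_span_range_iff_exists_fun ℝ).1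
      (show x ∈ Submodule.span ℝ (Set.range ![a, b]) from hx)
    simp [Fin.sum_univ_two, hαa, hαb, hβa, hβb]
  -- On P this form vanishes only along a + b and a + μb, while q a = -μ > 0 and q b = -1. Its sign
  -- disconnects the set.
  let q : RVec d → ℝ := fun x => (α x - β x) * (β x - μ * α x)
  have hq : Continuous q := by fun_prop
  have hqs : ∀ (c : ℝ) (x : RVec d), q (c • x) = c ^ 2 * q x := by
    intro c x; simp [q]; ring
  have hopen₁ := isOpen_setOf_exists_pos hq hqs
  have hopen₂ := isOpen_setOf_exists_pos (q := fun x => -q x) hq.neg (by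
    intro c x; simp only [hqs]; ring)
  have hdim : ∀ L ∈ projLine P ∩ D, ∀ x ∈ L.1, x ≠ 0 → q x ≠ 0 := by
    rintro L ⟨hLP, hLD⟩ x hx hx0 hqx
    have hxr := hrep x (hLP hx)
    rcases mul_eq_zero.1 hqx with h | h
    · have h' : α x = β x := by linarith
      have hβ0 : β x ≠ 0 := by
        intro h0; apply hx0; rw [hxr, h', h0]; simp
      refine h₁ L hLD ?_
      have : a + b = (β x)⁻¹ • x := by
        rw [eq_inv_smul_iff₀ hβ0, smul_add]
        nth_rw 1 [← h']
        exact hxr.symm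
      rw [this]; exact L.1.smul_mem _ hx
    · have h' : β x = μ * α x := by linarith
      have hα0 : α x ≠ 0 := by
        intro h0; apply hx0; rw [hxr, h', h0]; simp
      refine h₂ L hLD ?_
      have : a + μ • b = (α x)⁻¹ • x := by
        rw [eq_inv_smul_iff₀ hα0, smul_add, smul_smul, mul_comm, ← h', ← hxr]
      rw [this]; exact L.1.smul_mem _ hx
  have hline : ∀ {L : Grass 1 d} {x : RVec d}, x ∈ L.1 → x ≠ 0 → ∀ y ∈ L.1, ∃ c : ℝ, y = c • x := by
    intro L x hx hx0 y hy
    have h1 := (finrank_eq_one_iff_of_nonzero' (⟨x, hx⟩ : L.1)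
      (by simpa [Subtype.ext_iff] using hx0)).1 L.2 ⟨y, hy⟩
    obtain ⟨c, hc⟩ := h1
    exact ⟨c, by simpa using (congrArg Subtype.val hc).symm⟩
  have hmemP : ∀ {L : Grass 1 d} {x : RVec d}, x ∈ L.1 → x ≠ 0 → x ∈ P.1 → L ∈ projLine P := by
    intro L x hx hx0 hxP y hy
    obtain ⟨c, rfl⟩ := hline hx hx0 y hy
    exact P.1.smul_mem _ hxP
  have ha0 : a ≠ 0 := hab.ne_zero 0
  have hb0 : b ≠ 0 := hab.ne_zero 1
  obtain ⟨La, hLaD, hLa⟩ := ha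
  obtain ⟨Lb, hLbD, hLb⟩ := hb
  have hsub : projLine P ∩ D ⊆ {L | ∃ x ∈ L.1, 0 < q x} ∪ {L | ∃ x ∈ L.1, 0 < -q x} := by
    intro L hL
    obtain ⟨x, hx, hx0⟩ := Submodule.exists_mem_ne_zero_of_ne_bot
      (p := L.1) (fun h => by have := L.2; rw [h, finrank_bot] at this; exact zero_ne_one this)
    rcases lt_or_gt_of_ne (hdim L hL x hx hx0) with h | h
    · exact Or.inr ⟨x, hx, neg_pos.2 h⟩
    · exact Or.inl ⟨x, hx, h⟩
  obtain ⟨L, -, ⟨x, hx, hqx⟩, y, hy, hqy⟩ := hD P _ _ hopen₁ hopen₂ hsub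
    ⟨La, ⟨hmemP hLa ha0 haP, hLaD⟩, a, hLa, by simp [q, hαa, hβa, hμ]⟩
    ⟨Lb, ⟨hmemP hLb hb0 hbP, hLbD⟩, b, hLb, by simp [q, hαb, hβb]⟩
  have hx0 : x ≠ 0 := by
    rintro rfl; simp [q] at hqx
  obtain ⟨c, rfl⟩ := hline hx hx0 y hy
  rw [hqs] at hqy
  nlinarith [sq_nonneg c]

end ProjectiveLine

/-! ### The obstruction to semiconvexity -/

section Obstruction

variable {i j d : ℕ}

/-- If the four invariant planes of `B 0` and `B 1` are met, in alternating order, by a projective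
line, then no unstable multicone is locally semiconvex. -/
theorem not_locallySemiconvex_of_crossing {B : C(unitInterval, GL (Fin d) ℝ)}
    {E₀ E₁ : Grass i d} {F₀ F₁ : Grass j d}
    (h₀ : IsHyperbolicSplitting (B 0) E₀ F₀) (h₁ : IsHyperbolicSplitting (B 1) E₁ F₁)
    (h₀₀ : IsCompl E₀.1 F₀.1) (h₀₁ : IsCompl E₀.1 F₁.1)
    {a b : RVec d} {μ : ℝ} (ha : a ∈ E₀.1) (hb : b ∈ E₁.1) (hμ : μ < 0)
    (hab : LinearIndependent ℝ ![a, b]) (hc₀ : a + b ∈ F₀.1) (hc₁ : a + μ • b ∈ F₁.1)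
    {C : Set (Grass i d)} (hC : IsUnstableMulticone (Set.range B) C) :
    ¬ LocallySemiconvex C := by
  intro hconv
  have hM : ∀ t, B t ∈ Set.range B := fun t => ⟨t, rfl⟩
  obtain ⟨G, hG, hFG⟩ := exists_mem_isCompl isOpen_interior (hC.interior_nonempty (hM 0)) h₀₀
  have hE₀ : E₀ ∈ C :=
    interior_subset (hC.left_mem_interior (hM 0) h₀ (interior_subset hG) hFG)
  have hE₁ : E₁ ∈ C := interior_subset (hC.left_mem_interior (hM 1) h₁ hE₀ h₀₁.symm)
  -- All these curves pass through E₀, which B 0 fixes, so their union is connected. Their endpoints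
  -- at t = 1 converge to E₁.
  let Z : Set (Grass i d) := ⋃ n : ℕ, Set.range fun t => glMap (B t ^ n) E₀
  have hZ : IsPreconnected Z := by
    refine isPreconnected_iUnion ⟨E₀, Set.mem_iInter.2 fun n => ⟨0, ?_⟩⟩ fun n => ?_
    · exact glMap_pow_eq h₀.glMap_left n
    · exact isPreconnected_range (continuous_glMap_apply (B.continuous.pow n) E₀)
  have hZC : Z ⊆ C := by
    refine Set.iUnion_subset fun n => ?_
    rintro _ ⟨t, rfl⟩
    exact hC.glMap_pow_mem (hM t) hE₀ n
  have hZ₁ : E₁ ∈ closure Z := mem_closure_iff.2 fun O hO hmem => by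
    obtain ⟨n, hn⟩ := (h₁.eventually_glMap_pow_mem h₀₁.symm hO hmem).exists
    exact ⟨_, hn, Set.mem_iUnion.2 ⟨n, 1, rfl⟩⟩
  have hZ₀ : E₀ ∈ Z := Set.mem_iUnion.2 ⟨0, 0, by simp [glMap_one]⟩
  have hconn : insert E₁ Z ⊆ connectedComponentIn C E₀ :=
    (hZ.subset_closure (Set.subset_insert _ _)
      (Set.insert_subset hZ₁ subset_closure)).subset_connectedComponentIn
      (Set.mem_insert_of_mem _ hZ₀) (Set.insert_subset hE₁ hZC)
  have hsc := hconv _ ⟨E₀, hE₀, rfl⟩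
  have hKC := connectedComponentIn_subset C E₀
  have hdir : ∀ {E : Grass i d} {x : RVec d}, E ∈ connectedComponentIn C E₀ → x ∈ E.1 → x ≠ 0 →
      ∃ L ∈ directions (connectedComponentIn C E₀), x ∈ L.1 := by
    intro E x hE hx hx0
    refine ⟨⟨Submodule.span ℝ {x}, finrank_span_singleton hx0⟩, ⟨E, hE, ?_⟩,
      Submodule.mem_span_singleton_self x⟩
    exact (Submodule.span_singleton_le_iff_mem _ _).2 hx
  have hmiss : ∀ {F : Grass j d} {x : RVec d}, (∀ G ∈ C, Disjoint G.1 F.1) → x ∈ F.1 → x ≠ 0 →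
      ∀ L ∈ directions (connectedComponentIn C E₀), x ∉ L.1 := by
    rintro F x hF hx hx0 L ⟨E, hE, hLE⟩ hxL
    exact hx0 (Submodule.disjoint_def.1 (hF E (hKC hE)) x (hLE hxL) hx)
  have hind := LinearIndependent.pair_iff.1 hab
  refine hsc.not_separated hab hμ
    (hdir (hconn (Set.mem_insert_of_mem _ hZ₀)) ha (hab.ne_zero 0))
    (hdir (hconn (Set.mem_insert _ _)) hb (hab.ne_zero 1))
    (hmiss (fun G hG => hC.disjoint_right (hM 0) h₀ hE₀ hG) hc₀ fun h => ?_)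
    (hmiss (fun G hG => hC.disjoint_right (hM 1) h₁ hE₁ hG) hc₁ fun h => ?_)
  · simpa using (hind 1 1 (by simpa using h)).1
  · simpa using (hind 1 μ (by simpa using h)).1

end Obstruction

/-! ### Min-max bounds for singular values -/

section SingularValues

variable {d : ℕ}

theorem norm_sq_apply_eq_sum (T : RVec d →ₗ[ℝ] RVec d) (v : RVec d) :
    ‖T v‖ ^ 2 = ∑ k : Fin d, T.singularValues k ^ 2 *
      (T.isSymmetric_adjoint_comp_self.eigenvectorBasis finrank_euclideanSpace_fin).repr v k ^ 2 := by
  set hS := T.isSymmetric_adjoint_comp_self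
  set b := hS.eigenvectorBasis finrank_euclideanSpace_fin
  have h1 : ‖T v‖ ^ 2 = inner ℝ v ((LinearMap.adjoint T ∘ₗ T) v) := by
    rw [LinearMap.comp_apply, LinearMap.adjoint_inner_right, real_inner_self_eq_norm_sq]
  rw [h1, ← b.repr.inner_map_map, PiLp.inner_apply]
  refine Finset.sum_congr rfl fun k _ => ?_
  rw [hS.eigenvectorBasis_apply_self_apply finrank_euclideanSpace_fin,
    T.sq_singularValues_fin finrank_euclideanSpace_fin]
  simp only [RCLike.inner_apply, conj_trivial, RCLike.ofReal_real_eq_id, id]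
  ring

theorem finrank_span_image_basis (b : OrthonormalBasis (Fin d) ℝ (RVec d)) (s : Finset (Fin d)) :
    Module.finrank ℝ (Submodule.span ℝ (b '' s)) = s.card := by
  have h : LinearIndependent ℝ (fun k : s => b k) :=
    b.orthonormal.linearIndependent.comp _ Subtype.val_injective
  have := finrank_span_eq_card h
  rw [Fintype.card_coe] at this
  rwa [show Set.range (fun k : s => b k) = b '' s by ext x; simp] at this

theorem repr_eq_zero_of_mem_span (b : OrthonormalBasis (Fin d) ℝ (RVec d)) {s : Finset (Fin d)}
    {v : RVec d} (hv : v ∈ Submodule.span ℝ (b '' s)) {k : Fin d} (hk : k ∉ s) :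
    b.repr v k = 0 := by
  induction hv using Submodule.span_induction with
  | mem x hx =>
    obtain ⟨l, hl, rfl⟩ := hx
    have : k ≠ l := fun h => hk (h ▸ hl)
    simp [this]
  | zero => simp
  | add x y _ _ hx hy => simp [hx, hy]
  | smul c x _ hx => simp [hx]

theorem exists_mem_ne_zero_of_finrank (V : Submodule ℝ (RVec d))
    (b : OrthonormalBasis (Fin d) ℝ (RVec d)) (s : Finset (Fin d))
    (h : d < Module.finrank ℝ V + s.card) :
    ∃ v ∈ V, v ≠ 0 ∧ ∀ k ∉ s, b.repr v k = 0 := by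
  by_contra! hcon
  have hdis : Disjoint V (Submodule.span ℝ (b '' s)) := by
    rw [Submodule.disjoint_def]
    intro v hv hv'
    by_contra h0
    obtain ⟨k, hk, hne⟩ := hcon v hv h0
    exact hne (repr_eq_zero_of_mem_span b hv' hk)
  have := Submodule.finrank_add_finrank_le_of_disjoint hdis
  rw [finrank_span_image_basis, finrank_euclideanSpace_fin] at this
  omega

theorem sum_repr_sq (b : OrthonormalBasis (Fin d) ℝ (RVec d)) (v : RVec d) :
    ‖v‖ ^ 2 = ∑ k, b.repr v k ^ 2 := by
  rw [← b.repr.norm_map, EuclideanSpace.norm_sq_eq]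
  simp

/-- A lower bound for a linear map on a subspace of dimension greater than `k` bounds from below
the singular value of index `k` (counted from `0`). -/
theorem le_singularValues {T : RVec d →ₗ[ℝ] RVec d} {V : Submodule ℝ (RVec d)} {k : ℕ}
    (hk : k < Module.finrank ℝ V) {m : ℝ} (hm : ∀ v ∈ V, m * ‖v‖ ≤ ‖T v‖) :
    m ≤ T.singularValues k := by
  set b := T.isSymmetric_adjoint_comp_self.eigenvectorBasis (finrank_euclideanSpace_fin (n := d))
  have hkd : k < d := by
    have := V.finrank_le
    rw [finrank_euclideanSpace_fin] at this
    omega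
  -- The eigenvectors numbered from k on span a space of dimension d - k, which must meet V; T
  -- stretches it by at most the singular value of index k.
  obtain ⟨v, hv, hv0, hs⟩ := exists_mem_ne_zero_of_finrank V b (Finset.Ici ⟨k, hkd⟩)
    (by rw [Fin.card_Ici]; simp only; omega)
  have h1 : ‖T v‖ ^ 2 ≤ (T.singularValues k * ‖v‖) ^ 2 := by
    rw [norm_sq_apply_eq_sum, mul_pow, sum_repr_sq b, Finset.mul_sum]
    refine Finset.sum_le_sum fun l _ => ?_
    by_cases hl : l ∈ Finset.Ici (⟨k, hkd⟩ : Fin d)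
    · have hle : k ≤ l := Fin.le_def.1 (Finset.mem_Ici.1 hl)
      have h2 := T.singularValues_antitone hle
      have h3 := T.singularValues_nonneg l
      gcongr
    · have := hs l hl
      change T.singularValues l ^ 2 * b.repr v l ^ 2 ≤ _
      rw [this]; simp
  have h4 := abs_le_of_sq_le_sq h1 (by have := T.singularValues_nonneg k; positivity)
  rw [abs_of_nonneg (norm_nonneg _)] at h4
  exact le_of_mul_le_mul_right ((hm v hv).trans h4) (norm_pos_iff.2 hv0)

/-- An upper bound for a linear map on a subspace of codimension at most `k` bounds from above
the singular value of index `k` (counted from `0`). -/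
theorem singularValues_le {T : RVec d →ₗ[ℝ] RVec d} {V : Submodule ℝ (RVec d)} {k : ℕ}
    (hkd : k < d) (hk : d ≤ k + Module.finrank ℝ V) {m : ℝ} (hm : ∀ v ∈ V, ‖T v‖ ≤ m * ‖v‖) :
    T.singularValues k ≤ m := by
  set b := T.isSymmetric_adjoint_comp_self.eigenvectorBasis (finrank_euclideanSpace_fin (n := d))
  obtain ⟨v, hv, hv0, hs⟩ := exists_mem_ne_zero_of_finrank V b (Finset.Iic ⟨k, hkd⟩)
    (by rw [Fin.card_Iic]; simp only; omega)
  have h1 : (T.singularValues k * ‖v‖) ^ 2 ≤ ‖T v‖ ^ 2 := by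
    rw [norm_sq_apply_eq_sum, mul_pow, sum_repr_sq b, Finset.mul_sum]
    refine Finset.sum_le_sum fun l _ => ?_
    by_cases hl : l ∈ Finset.Iic (⟨k, hkd⟩ : Fin d)
    · have hle : (l : ℕ) ≤ k := Fin.le_def.1 (Finset.mem_Iic.1 hl)
      have h2 := T.singularValues_antitone hle
      have h3 := T.singularValues_nonneg k
      gcongr
    · have := hs l hl
      change _ ≤ T.singularValues l ^ 2 * b.repr v l ^ 2
      rw [this]; simp
  have h4 := le_of_sq_le_sq h1 (norm_nonneg _)
  exact le_of_mul_le_mul_right (h4.trans (hm v hv)) (norm_pos_iff.2 hv0)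

end SingularValues

/-! ### Domination from expanded cones -/

section Domination

variable {d : ℕ}

/-- `U` is mapped into itself by the elements of `S`, which expand the vectors of `U` by a factor
of at least `2`. -/
def ExpandsCone (S : Set (GL (Fin d) ℝ)) (U : Set (RVec d)) : Prop :=
  ∀ M ∈ S, ∀ v ∈ U, glEquiv M v ∈ U ∧ 2 * ‖v‖ ≤ ‖glEquiv M v‖

theorem ExpandsCone.list_prod {S : Set (GL (Fin d) ℝ)} {U : Set (RVec d)} (h : ExpandsCone S U)
    (l : List (GL (Fin d) ℝ)) (hl : ∀ M ∈ l, M ∈ S) {v : RVec d} (hv : v ∈ U) :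
    glEquiv l.prod v ∈ U ∧ 2 ^ l.length * ‖v‖ ≤ ‖glEquiv l.prod v‖ := by
  induction l with
  | nil => simpa [glEquiv_one_apply] using hv
  | cons M l ih =>
    obtain ⟨h1, h2⟩ := ih fun N hN => hl N (List.mem_cons_of_mem _ hN)
    obtain ⟨h3, h4⟩ := h M (hl M List.mem_cons_self) _ h1
    rw [List.prod_cons, glEquiv_mul_apply, List.length_cons, pow_succ']
    exact ⟨h3, by linarith⟩

theorem dominatedOfIndex_of_expandsCone {i : ℕ} (hi : 1 ≤ i) (hid : i < d)
    {S : Set (GL (Fin d) ℝ)} {U U' : Set (RVec d)} (hU : ExpandsCone S U)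
    (hU' : ExpandsCone S⁻¹ U') (E : Grass i d) (F : Grass (d - i) d)
    (hE : ∀ v ∈ E.1, v ∈ U) (hF : ∀ v ∈ F.1, v ∈ U') : DominatedOfIndex i S := by
  -- The bounds below make the ratio at most 4⁻ᴺ. A constant c > 1 is needed since the empty product
  -- has ratio 1.
  refine ⟨2, 1 / 2, by norm_num, by norm_num, by norm_num, fun l hl => ?_⟩
  have h1 : (2 : ℝ) ^ l.length ≤ sigmaVal i l.prod :=
    le_singularValues (V := E.1) (by rw [E.2]; omega) fun v hv => (hU.list_prod l hl (hE v hv)).2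
  have h2 : sigmaVal (i + 1) l.prod ≤ ((2 : ℝ) ^ l.length)⁻¹ := by
    -- The test space is the preimage of F under the product: the inverse product expands F, so the
    -- product contracts this preimage.
    refine singularValues_le (V := (glMap l.prod⁻¹ F).1) (by omega)
      (by rw [(glMap l.prod⁻¹ F).2]; omega) fun v hv => ?_
    have h3 := (mem_glMap _ _ _).1 hv
    rw [inv_inv] at h3
    have h4 := (hU'.list_prod (l.map fun M => M⁻¹).reverse (by
      intro M hM
      simp only [List.mem_reverse, List.mem_map] at hM
      obtain ⟨N, hN, rfl⟩ := hM
      exact Set.inv_mem_inv.2 (hl N hN)) (hF _ h3)).2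
    rw [← List.prod_inv_reverse, glEquiv_inv_apply_self, List.length_reverse, List.length_map] at h4
    rw [inv_mul_eq_div, le_div_iff₀' (by positivity)]
    exact h4
  have h5 : (0 : ℝ) < 2 ^ l.length := by positivity
  have h6 : (1 : ℝ) ≤ 2 ^ l.length := one_le_pow₀ (by norm_num)
  rw [div_lt_iff₀ (h5.trans_le h1), one_div, inv_pow]
  have h7 : 0 < ((2 : ℝ) ^ l.length)⁻¹ := inv_pos.2 h5
  nlinarith

/-- A common vector v would satisfy both 2‖v‖ ≤ ‖Mv‖ and 2‖Mv‖ ≤ ‖v‖. -/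
theorem isCompl_of_expandsCone {S : Set (GL (Fin d) ℝ)} {U U' : Set (RVec d)}
    (hU : ExpandsCone S U) (hU' : ExpandsCone S⁻¹ U') {i j : ℕ} (hij : i + j = d)
    {E : Grass i d} {F : Grass j d} (hE : ∀ v ∈ E.1, v ∈ U) (hF : ∀ v ∈ F.1, v ∈ U')
    {M : GL (Fin d) ℝ} (hM : M ∈ S) (hmap : glMap M F = F) : IsCompl E.1 F.1 := by
  rw [Submodule.isCompl_iff_disjoint]
  · rw [Submodule.disjoint_def]
    intro v hvE hvF
    have h1 := (hU _ hM v (hE v hvE)).2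
    have h2 : glEquiv M v ∈ F.1 := by
      have := apply_mem_glMap M hvF
      rwa [hmap] at this
    have h3 := (hU' M⁻¹ (Set.inv_mem_inv.2 hM) _ (hF _ h2)).2
    rw [glEquiv_inv_apply_self] at h3
    have := norm_nonneg v
    exact norm_eq_zero.1 (by linarith)
  · rw [E.2, F.2, finrank_euclideanSpace_fin, hij]

end Domination

/-! ### Assembling the obstruction, and its symmetry under inversion -/

section Package

/-- Data that prevent the range of `B`, and the inverse of this set, from having a locally
semiconvex multicone: invariant cones, invariant planes of `B 0` and `B 1` inside of them, and a
projective line that meets these four planes in alternating order. -/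
structure HasCrossing (B : C(unitInterval, GL (Fin 4) ℝ)) (U U' : Set (RVec 4))
    (E₀ E₁ F₀ F₁ : Grass 2 4) : Prop where
  expandsCone : ExpandsCone (Set.range B) U
  expandsCone_inv : ExpandsCone (Set.range B)⁻¹ U'
  map_E₀ : glMap (B 0) E₀ = E₀
  map_E₁ : glMap (B 1) E₁ = E₁
  map_F₀ : glMap (B 0) F₀ = F₀
  map_F₁ : glMap (B 1) F₁ = F₁
  E₀_subset : ∀ v ∈ E₀.1, v ∈ U
  E₁_subset : ∀ v ∈ E₁.1, v ∈ U
  F₀_subset : ∀ v ∈ F₀.1, v ∈ U'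
  F₁_subset : ∀ v ∈ F₁.1, v ∈ U'
  crossing : ∃ a ∈ E₀.1, ∃ b ∈ E₁.1, ∃ μ < (0 : ℝ), LinearIndependent ℝ ![a, b] ∧
    a + b ∈ F₀.1 ∧ a + μ • b ∈ F₁.1

namespace HasCrossing

variable {B : C(unitInterval, GL (Fin 4) ℝ)} {U U' : Set (RVec 4)} {E₀ E₁ F₀ F₁ : Grass 2 4}

theorem inv (h : HasCrossing B U U' E₀ E₁ F₀ F₁) : HasCrossing B⁻¹ U' U F₀ F₁ E₀ E₁ where
  expandsCone := by
    have := h.expandsCone_inv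
    rwa [Set.inv_range] at this
  expandsCone_inv := by
    have := h.expandsCone
    rw [Set.inv_range]
    simpa using this
  map_E₀ := glMap_inv_eq h.map_F₀
  map_E₁ := glMap_inv_eq h.map_F₁
  map_F₀ := glMap_inv_eq h.map_E₀
  map_F₁ := glMap_inv_eq h.map_E₁
  E₀_subset := h.F₀_subset
  E₁_subset := h.F₁_subset
  F₀_subset := h.E₀_subset
  F₁_subset := h.E₁_subset
  crossing := by
    obtain ⟨a, ha, b, hb, μ, hμ, hab, h₀, h₁⟩ := h.crossing
    have hμ0 : μ ≠ 0 := hμ.ne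
    -- With a' = a + b and b' = -μ⁻¹(a + μb), the vectors a' + b' and a' + μb' are multiples of a
    -- and b: the crossing condition is symmetric, with the same μ.
    refine ⟨a + b, h₀, (-μ⁻¹) • (a + μ • b), F₁.1.smul_mem _ h₁, μ, hμ, ?_, ?_, ?_⟩
    · rw [LinearIndependent.pair_iff] at hab ⊢
      intro s t hst
      obtain ⟨h1, h2⟩ := hab (s - t * μ⁻¹) (s - t) (by
        rw [← hst, smul_add, smul_add, smul_add, smul_smul, smul_smul, smul_smul,
          show t * -μ⁻¹ * μ = -t by field_simp]
        module)
      have h3 : t * (1 - μ) = 0 := by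
        field_simp at h1
        linear_combination μ * h2 - h1
      have h4 : t = 0 := by
        rcases mul_eq_zero.1 h3 with h | h
        · exact h
        · linarith
      exact ⟨by linarith, h4⟩
    · have : a + b + (-μ⁻¹) • (a + μ • b) = (1 - μ⁻¹) • a := by
        rw [smul_add, smul_smul, show -μ⁻¹ * μ = -1 by field_simp]
        module
      rw [this]
      exact E₀.1.smul_mem _ ha
    · have : a + b + μ • (-μ⁻¹) • (a + μ • b) = (1 - μ) • b := by
        rw [smul_smul, show μ * -μ⁻¹ = -1 by field_simp]
        module
      rw [this]
      exact E₁.1.smul_mem _ hb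

theorem isHyperbolicSplitting (h : HasCrossing B U U' E₀ E₁ F₀ F₁) {t : unitInterval}
    {E F : Grass 2 4} (hE : ∀ v ∈ E.1, v ∈ U) (hF : ∀ v ∈ F.1, v ∈ U')
    (hEmap : glMap (B t) E = E) (hFmap : glMap (B t) F = F) :
    IsHyperbolicSplitting (B t) E F where
  glMap_left := hEmap
  glMap_right := hFmap
  expands v hv := (h.expandsCone _ ⟨t, rfl⟩ v (hE v hv)).2
  contracts v hv := (h.expandsCone_inv _ (Set.inv_mem_inv.2 ⟨t, rfl⟩) v (hF v hv)).2

theorem not_locallySemiconvex (h : HasCrossing B U U' E₀ E₁ F₀ F₁) {C : Set (Grass 2 4)}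
    (hC : IsUnstableMulticone (Set.range B) C) : ¬ LocallySemiconvex C := by
  obtain ⟨a, ha, b, hb, μ, hμ, hab, h₀, h₁⟩ := h.crossing
  exact not_locallySemiconvex_of_crossing
    (h.isHyperbolicSplitting h.E₀_subset h.F₀_subset h.map_E₀ h.map_F₀)
    (h.isHyperbolicSplitting h.E₁_subset h.F₁_subset h.map_E₁ h.map_F₁)
    (isCompl_of_expandsCone h.expandsCone h.expandsCone_inv rfl h.E₀_subset h.F₀_subset
      ⟨0, rfl⟩ h.map_F₀)
    (isCompl_of_expandsCone h.expandsCone h.expandsCone_inv rfl h.E₀_subset h.F₁_subset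
      ⟨1, rfl⟩ h.map_F₁) ha hb hμ hab h₀ h₁ hC

theorem dominatedNoSemiconvexMulticone (h : HasCrossing B U U' E₀ E₁ F₀ F₁) :
    DominatedNoSemiconvexMulticone 2 (Set.range B) := by
  refine ⟨dominatedOfIndex_of_expandsCone (by norm_num) (by norm_num) h.expandsCone
    h.expandsCone_inv E₀ F₀ h.E₀_subset h.F₀_subset, ?_, ?_⟩
  · rintro ⟨C, hC, hconv⟩
    exact h.not_locallySemiconvex hC hconv
  · rintro ⟨C, hC, hconv⟩
    have hC' : IsUnstableMulticone (Set.range (B⁻¹ : C(unitInterval, GL (Fin 4) ℝ)))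
        (C : Set (Grass 2 4)) := by
      have : Set.range (B⁻¹ : C(unitInterval, GL (Fin 4) ℝ)) = (Set.range B)⁻¹ := by
        rw [Set.inv_range]; rfl
      rw [this]
      exact hC
    exact h.inv.not_locallySemiconvex hC' hconv

end HasCrossing

end Package

open scoped Matrix.Norms.L2Operator

/-! ### Invariant planes of perturbations by graph transform -/

section InvariantGraph

variable {R : Type*} [NormedRing R] [NormedAlgebra ℝ R] [CompleteSpace R]

/-- The graph transform of a perturbation of a linear map that preserves the ranges of the
idempotents `p` and `q` has a fixed point. -/
theorem exists_fixedPoint_graphTransform {p q H : R} (hp : p * p = p) (hq : q * q = q)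
    (hp1 : ‖p‖ ≤ 1) (hq1 : ‖q‖ ≤ 1) {κ δ : ℝ} (hκ : |κ| ≤ 1) (hδ0 : 0 ≤ δ) (hδ1 : δ ≤ 1)
    (hH : ‖H‖ ≤ δ / 8) :
    ∃ S : R, ‖S‖ ≤ δ ∧ p * S = S ∧ S * q = S ∧ S = κ • ((S * H - p * H) * (q + S)) := by
  have hpaq : ∀ a : R, ‖κ • (p * a * q)‖ ≤ ‖a‖ := by
    intro a
    calc ‖κ • (p * a * q)‖ ≤ |κ| * (‖p‖ * ‖a‖ * ‖q‖) := by
          rw [norm_smul, Real.norm_eq_abs]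
          gcongr
          exact (norm_mul_le _ _).trans (by gcongr; exact norm_mul_le _ _)
      _ ≤ 1 * (1 * ‖a‖ * 1) := by gcongr
      _ = ‖a‖ := by ring
  -- The outer factors p and q force every fixed point to satisfy pS = S = Sq, so the contraction
  -- can be run on the whole ball. They also allow H in place of pH.
  let f : R → R := fun S => κ • (p * ((S * H - H) * (q + S)) * q)
  have hSH : ∀ {S : R}, ‖S‖ ≤ δ → ‖S * H - H‖ ≤ δ / 4 := by
    intro S hS
    calc ‖S * H - H‖ ≤ ‖S‖ * ‖H‖ + ‖H‖ := (norm_sub_le _ _).trans (by gcongr; exact norm_mul_le _ _)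
      _ ≤ 1 * (δ / 8) + δ / 8 := by gcongr; exact hS.trans hδ1
      _ = δ / 4 := by ring
  have hqS : ∀ {S : R}, ‖S‖ ≤ δ → ‖q + S‖ ≤ 2 := by
    intro S hS
    exact (norm_add_le _ _).trans (by linarith)
  have hmaps : Set.MapsTo f (Metric.closedBall 0 δ) (Metric.closedBall 0 δ) := by
    intro S hS
    rw [mem_closedBall_zero_iff] at hS ⊢
    calc ‖f S‖ ≤ ‖S * H - H‖ * ‖q + S‖ := (hpaq _).trans (norm_mul_le _ _)
      _ ≤ δ / 4 * 2 := by gcongr; exacts [hSH hS, hqS hS]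
      _ ≤ δ := by linarith
  have hlip : ContractingWith (1 / 2) (hmaps.restrict f _ _) := by
    refine ⟨by rw [← NNReal.coe_lt_coe]; norm_num, LipschitzWith.of_dist_le_mul ?_⟩
    rintro ⟨S₁, hS₁⟩ ⟨S₂, hS₂⟩
    rw [mem_closedBall_zero_iff] at hS₁ hS₂
    change dist (f S₁) (f S₂) ≤ ((1 / 2 : NNReal) : ℝ) * dist S₁ S₂
    rw [dist_eq_norm, dist_eq_norm]
    have h1 : f S₁ - f S₂ =
        κ • (p * ((S₁ - S₂) * (H * (q + S₁)) + (S₂ * H - H) * (S₁ - S₂)) * q) := by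
      simp only [f, ← smul_sub]
      congr 1
      noncomm_ring
    rw [h1]
    have h2 : ‖H * (q + S₁)‖ ≤ 1 / 4 := by
      calc _ ≤ ‖H‖ * ‖q + S₁‖ := norm_mul_le _ _
        _ ≤ δ / 8 * 2 := by gcongr; exact hqS hS₁
        _ ≤ 1 / 4 := by linarith
    have h3 : ‖S₂ * H - H‖ ≤ 1 / 4 := (hSH hS₂).trans (by linarith)
    calc _ ≤ ‖(S₁ - S₂) * (H * (q + S₁)) + (S₂ * H - H) * (S₁ - S₂)‖ := hpaq _
      _ ≤ ‖S₁ - S₂‖ * ‖H * (q + S₁)‖ + ‖S₂ * H - H‖ * ‖S₁ - S₂‖ :=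
        (norm_add_le _ _).trans (add_le_add (norm_mul_le _ _) (norm_mul_le _ _))
      _ ≤ ‖S₁ - S₂‖ * (1 / 4) + 1 / 4 * ‖S₁ - S₂‖ := by gcongr
      _ = ((1 / 2 : NNReal) : ℝ) * ‖S₁ - S₂‖ := by push_cast; ring
  obtain ⟨S, hS, hfix, -⟩ := hlip.exists_fixedPoint'
    Metric.isClosed_closedBall.isComplete hmaps (x := 0) (by simpa using hδ0) (edist_ne_top _ _)
  have hS' : κ • (p * ((S * H - H) * (q + S)) * q) = S := hfix
  have hpS : p * S = S := by
    rw [← hS', mul_smul_comm, ← mul_assoc, ← mul_assoc, hp]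
  have hSq : S * q = S := by
    rw [← hS', smul_mul_assoc, mul_assoc _ q q, hq]
  refine ⟨S, by simpa using hS, hpS, hSq, ?_⟩
  conv_lhs => rw [← hS']
  congr 1
  have h1 : p * ((S * H - H) * (q + S)) * q = ((p * S) * H - p * H) * (q * q + S * q) := by
    noncomm_ring
  rw [h1, hpS, hq, hSq]

/-- An element close to `λ p + λ' q` preserves the range of an element close to `q`. -/
theorem exists_invariant_graph {p q T : R} (hpq : p * q = 0) (hqp : q * p = 0) (hadd : p + q = 1)
    (hp1 : ‖p‖ ≤ 1) (hq1 : ‖q‖ ≤ 1) {a b δ : ℝ} (hab : 1 ≤ |a - b|) (hδ0 : 0 ≤ δ) (hδ1 : δ ≤ 1)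
    (hT : ‖T - (a • p + b • q)‖ ≤ δ / 8) :
    ∃ S : R, ‖S‖ ≤ δ ∧ S * p = 0 ∧ T * (q + S) = (q + S) * (T * (q + S)) := by
  have hp : p * p = p := by
    have : p * (p + q) = p := by rw [hadd, mul_one]
    rwa [mul_add, hpq, add_zero] at this
  have hq : q * q = q := by
    have : q * (p + q) = q := by rw [hadd, mul_one]
    rwa [mul_add, hqp, zero_add] at this
  have hab0 : a - b ≠ 0 := by
    intro h; rw [h, abs_zero] at hab; linarith
  obtain ⟨S, hS, hpS, hSq, hfix⟩ := exists_fixedPoint_graphTransform hp hq hp1 hq1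
    (κ := (a - b)⁻¹) (by rw [abs_inv]; exact inv_le_one_of_one_le₀ hab) hδ0 hδ1 hT
  refine ⟨S, hS, by rw [← hSq, mul_assoc, hqp, mul_zero], ?_⟩
  set H := T - (a • p + b • q) with hH
  have hTe : T = a • p + b • q + H := by rw [hH]; abel
  have h1 : (a - b) • S = (S * H - p * H) * (q + S) := by
    conv_lhs => rw [hfix]
    rw [smul_smul, mul_inv_cancel₀ hab0, one_smul]
  -- This says that T maps the graph of S, the range of q + S, into itself. Expanding T = ap + bq +
  -- H turns it into the fixed point equation `h1`.
  have h2 : p * T * (q + S) = S * T * (q + S) := by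
    have hqS : q * S = 0 := by rw [← hpS, ← mul_assoc, hqp, zero_mul]
    have hSp : S * p = 0 := by rw [← hSq, mul_assoc, hqp, mul_zero]
    have h3 : p * T = a • p + p * H := by
      rw [hTe, mul_add, mul_add, mul_smul_comm, mul_smul_comm, hp, hpq, smul_zero, add_zero]
    have h4 : S * T = b • S + S * H := by
      rw [hTe, mul_add, mul_add, mul_smul_comm, mul_smul_comm, hSp, hSq, smul_zero, zero_add]
    have h5 : p * (q + S) = S := by rw [mul_add, hpq, hpS, zero_add]
    have h6 : S * (q + S) = S := by
      rw [mul_add, hSq]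
      nth_rw 2 [← hSq]
      rw [mul_assoc, hqS, mul_zero, add_zero]
    rw [h3, h4, add_mul, add_mul, smul_mul_assoc, smul_mul_assoc, h5, h6]
    rw [sub_mul, sub_smul] at h1
    rw [← sub_eq_zero] at h1 ⊢
    rw [← h1]
    abel
  calc T * (q + S) = (p + q) * (T * (q + S)) := by rw [hadd, one_mul]
    _ = p * T * (q + S) + q * (T * (q + S)) := by rw [add_mul, mul_assoc]
    _ = S * T * (q + S) + q * (T * (q + S)) := by rw [h2]
    _ = _ := by rw [add_mul, add_comm, mul_assoc]

/-- Simultaneous block diagonalisation of an element close to `λ p + λ' q`. -/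
theorem exists_block_diagonalization {p q : R} (hpq : p * q = 0) (hqp : q * p = 0)
    (hadd : p + q = 1) (hp1 : ‖p‖ ≤ 1) (hq1 : ‖q‖ ≤ 1) {a b : ℝ} (hab : 1 ≤ |a - b|) {δ : ℝ}
    (hδ0 : 0 ≤ δ) (hδ1 : δ ≤ 1) {T : R} (hT : ‖T - (a • p + b • q)‖ ≤ δ / 8) :
    ∃ h X Y : R, ‖h - 1‖ ≤ 2 * δ ∧ T * (h * p) = h * p * X ∧ T * (h * q) = h * q * Y := by
  obtain ⟨S, hS, hSp, hTS⟩ := exists_invariant_graph hpq hqp hadd hp1 hq1 hab hδ0 hδ1 hT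
  obtain ⟨S', hS', hSq', hTS'⟩ := exists_invariant_graph hqp hpq (by rw [add_comm, hadd]) hq1 hp1
    (a := b) (b := a) (by rwa [abs_sub_comm]) hδ0 hδ1 (by rwa [add_comm (b • q)])
  have hSq : S * q = S := by
    have : S * (p + q) = S := by rw [hadd, mul_one]
    rwa [mul_add, hSp, zero_add] at this
  have hSp' : S' * p = S' := by
    have : S' * (p + q) = S' := by rw [hadd, mul_one]
    rwa [mul_add, hSq', add_zero] at this
  -- This h sends the ranges of p and q to the two invariant graphs: hp = p + S' and hq = q + S.
  refine ⟨1 + (S + S'), T * (p + S'), T * (q + S), ?_, ?_, ?_⟩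
  · rw [add_sub_cancel_left]
    exact (norm_add_le _ _).trans (by linarith)
  · rw [show (1 + (S + S')) * p = p + S' by rw [add_mul, add_mul, one_mul, hSp, hSp', zero_add]]
    exact hTS'
  · rw [show (1 + (S + S')) * q = q + S by rw [add_mul, add_mul, one_mul, hSq, hSq', add_zero]]
    exact hTS

end InvariantGraph

/-! ### Invariant cones from uniform transversality -/

section Cone

variable {d : ℕ} {ι : Type*}

/-- The vectors close to one of the images of the range of `p` by the maps `g t`. -/
def approxCone (g : ι → GL (Fin d) ℝ) (p : RVec d →L[ℝ] RVec d) (ε : ℝ) : Set (RVec d) :=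
  {v | ∃ t y, p y = y ∧ ‖v - glEquiv (g t) y‖ ≤ ε * ‖y‖}

theorem expandsCone_approxCone {g : ι → GL (Fin d) ℝ} {p q : RVec d →L[ℝ] RVec d}
    (hpp : ∀ y, p (p y) = p y) (hp : ∀ y, ‖p y‖ ≤ ‖y‖) (hq : ∀ y, ‖q y‖ ≤ ‖y‖)
    {C δ l : ℝ} (hC : 1 ≤ C) (hg : ∀ t y, ‖glEquiv (g t) y‖ ≤ C * ‖y‖)
    (hg' : ∀ t y, ‖glEquiv (g t)⁻¹ y‖ ≤ C * ‖y‖) (hδ : 0 < δ) (hδ1 : δ ≤ 1)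
    (htr : ∀ s t y, p y = y → δ * ‖y‖ ≤ ‖p (glEquiv (g s)⁻¹ (glEquiv (g t) y))‖)
    (hl : 16 * C ^ 4 ≤ l * δ ^ 2) {B : ι → GL (Fin d) ℝ}
    (hB : ∀ t y, ‖glEquiv ((g t)⁻¹ * B t * g t) y - (l • p y + l⁻¹ • q y)‖ ≤ 1 / 2 * ‖y‖) :
    ExpandsCone (Set.range B) (approxCone g p (δ / (2 * C))) := by
  rintro _ ⟨s, rfl⟩ v ⟨t, y, hy, hv⟩
  have hC0 : 0 < C := by linarith
  set ε := δ / (2 * C) with hε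
  have hεC : C * ε = δ / 2 := by rw [hε]; field_simp
  have hε0 : 0 < ε := by positivity
  have hε1 : ε ≤ 1 / 2 := by rw [hε, div_le_iff₀ (by positivity)]; nlinarith
  have hlδ : 16 * C ^ 4 ≤ l * δ := by
    have hl0 : 0 < l := by
      by_contra! h
      have : 0 < 16 * C ^ 4 := by positivity
      nlinarith [sq_nonneg δ]
    nlinarith [mul_nonneg hl0.le hδ.le]
  have hC4 : C ^ 2 ≤ C ^ 4 := pow_le_pow_right₀ hC (by norm_num)
  have hC2 : 1 ≤ C ^ 2 := one_le_pow₀ hC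
  have hl2 : 2 ≤ l := by nlinarith
  have hy0 := norm_nonneg y
  set z := glEquiv (g s)⁻¹ v with hz
  have hvn : ‖v‖ ≤ 2 * C * ‖y‖ := by
    have h1 : ‖v‖ ≤ ‖v - glEquiv (g t) y‖ + ‖glEquiv (g t) y‖ := by
      simpa using norm_add_le (v - glEquiv (g t) y) (glEquiv (g t) y)
    have h2 := hg t y
    nlinarith
  have hzn : ‖z‖ ≤ 2 * C ^ 2 * ‖y‖ := by
    have h1 := hg' s v
    nlinarith
  -- Transversality gives δ‖y‖ for the exact vector g_t y. The aperture ε = δ/(2C) is chosen so that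
  -- the error of v costs at most half of this.
  have hpz : δ / 2 * ‖y‖ ≤ ‖p z‖ := by
    have h1 := htr s t y hy
    have h2 : p (glEquiv (g s)⁻¹ (glEquiv (g t) y)) =
        p z - p (glEquiv (g s)⁻¹ (v - glEquiv (g t) y)) := by
      rw [hz, map_sub, map_sub]; abel
    have h3 : ‖p (glEquiv (g s)⁻¹ (v - glEquiv (g t) y))‖ ≤ δ / 2 * ‖y‖ := by
      calc _ ≤ C * ‖v - glEquiv (g t) y‖ := (hp _).trans (hg' _ _)
        _ ≤ C * (ε * ‖y‖) := by gcongr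
        _ = δ / 2 * ‖y‖ := by rw [← hεC]; ring
    have h4 := norm_sub_le (p z) (p (glEquiv (g s)⁻¹ (v - glEquiv (g t) y)))
    rw [← h2] at h4
    linarith
  set y' := l • p z with hy'
  have hy'n : l * δ / 2 * ‖y‖ ≤ ‖y'‖ := by
    rw [hy', norm_smul, Real.norm_eq_abs, abs_of_pos (by linarith)]
    nlinarith
  have hpy' : p y' = y' := by rw [hy', map_smul, hpp]
  have hBv : glEquiv (B s) v = glEquiv (g s) (glEquiv ((g s)⁻¹ * B s * g s) z) := by
    rw [hz, ← glEquiv_mul_apply, ← glEquiv_mul_apply]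
    congr 2
    group
  have hdiff : ‖glEquiv (B s) v - glEquiv (g s) y'‖ ≤ 2 * C ^ 3 * ‖y‖ := by
    rw [hBv, ← map_sub]
    have h1 : ‖glEquiv ((g s)⁻¹ * B s * g s) z - y'‖ ≤ ‖z‖ := by
      have h2 : glEquiv ((g s)⁻¹ * B s * g s) z - y' =
          (glEquiv ((g s)⁻¹ * B s * g s) z - (l • p z + l⁻¹ • q z)) + l⁻¹ • q z := by
        rw [hy']; abel
      have h3 : ‖l⁻¹ • q z‖ ≤ 1 / 2 * ‖z‖ := by
        rw [norm_smul, norm_inv, Real.norm_eq_abs, abs_of_pos (by linarith)]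
        have : l⁻¹ ≤ 1 / 2 := by rw [one_div]; exact inv_anti₀ (by norm_num) hl2
        exact mul_le_mul this (hq z) (norm_nonneg _) (by norm_num)
      rw [h2]
      exact (norm_add_le _ _).trans (by linarith [hB s z])
    calc _ ≤ C * ‖glEquiv ((g s)⁻¹ * B s * g s) z - y'‖ := hg _ _
      _ ≤ C * (2 * C ^ 2 * ‖y‖) := by gcongr; exact h1.trans hzn
      _ = _ := by ring
  have hdiff' : ‖glEquiv (B s) v - glEquiv (g s) y'‖ ≤ ε * ‖y'‖ := by
    refine hdiff.trans ?_
    -- This is where l must be large compared with C⁴/δ²: the error is of order ‖y‖, while ‖y'‖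
    -- grows with l.
    have h1 : 2 * C ^ 3 ≤ ε * (l * δ / 2) := by
      rw [hε]
      rw [div_mul_eq_mul_div, le_div_iff₀ (by positivity)]
      have : 0 < C ^ 4 := by positivity
      nlinarith
    calc 2 * C ^ 3 * ‖y‖ ≤ ε * (l * δ / 2) * ‖y‖ := by gcongr
      _ = ε * (l * δ / 2 * ‖y‖) := by ring
      _ ≤ ε * ‖y'‖ := by gcongr
  refine ⟨⟨s, y', hpy', hdiff'⟩, ?_⟩
  have h1 : ‖y'‖ ≤ C * ‖glEquiv (g s) y'‖ := by
    have := hg' s (glEquiv (g s) y')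
    rwa [glEquiv_inv_apply_self] at this
  have h2 : ‖glEquiv (g s) y'‖ ≤ ‖glEquiv (B s) v‖ + ε * ‖y'‖ := by
    have := norm_sub_norm_le (glEquiv (g s) y') (glEquiv (B s) v)
    rw [norm_sub_rev] at this
    linarith
  have h3 : ‖y'‖ / 2 ≤ C * ‖glEquiv (B s) v‖ := by
    have h4 : C * ‖glEquiv (g s) y'‖ ≤ C * ‖glEquiv (B s) v‖ + δ / 2 * ‖y'‖ := by
      rw [← hεC]; nlinarith
    nlinarith [norm_nonneg y']
  -- Together with ‖v‖ ≤ 2C‖y‖ this gives the expansion by 2.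
  have h5 : C * (4 * C * ‖y‖) ≤ C * ‖glEquiv (B s) v‖ := by
    refine le_trans ?_ h3
    have : 16 * C ^ 2 ≤ l * δ := by linarith
    nlinarith
  have h6 := le_of_mul_le_mul_left h5 hC0
  linarith

/-- The bound is the minimum of a positive continuous function on a compact set of parameters and
unit vectors, truncated at 1. -/
theorem exists_transversality_bound [TopologicalSpace ι] [CompactSpace ι] {g : ι → GL (Fin d) ℝ}
    (hg : Continuous g) {p : RVec d →L[ℝ] RVec d}
    (htr : ∀ s t y, p y = y → p (glEquiv (g s)⁻¹ (glEquiv (g t) y)) = 0 → y = 0) :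
    ∃ δ > (0 : ℝ), δ ≤ 1 ∧
      ∀ s t y, p y = y → δ * ‖y‖ ≤ ‖p (glEquiv (g s)⁻¹ (glEquiv (g t) y))‖ := by
  let K : Set ((ι × ι) × RVec d) := Set.univ ×ˢ (Metric.sphere 0 1 ∩ {y | p y = y})
  have hK : IsCompact K := isCompact_univ.prod
    ((isCompact_sphere _ _).inter_right (isClosed_eq p.continuous continuous_id))
  let f : (ι × ι) × RVec d → ℝ := fun x =>
    ‖p (glEquiv (g x.1.1)⁻¹ (glEquiv (g x.1.2) x.2))‖
  have hact : ∀ {X : Type _} [TopologicalSpace X] {M : X → GL (Fin d) ℝ} {w : X → RVec d},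
      Continuous M → Continuous w → Continuous fun x => glEquiv (M x) (w x) := by
    intro X _ M w hM hw
    simp only [glEquiv_apply_eq]
    refine (PiLp.continuous_toLp 2 _).comp ?_
    exact (Units.continuous_val.comp hM).matrix_mulVec ((PiLp.continuous_ofLp 2 _).comp hw)
  have hf : Continuous f := by
    refine (p.continuous.comp (hact ?_ (hact ?_ continuous_snd))).norm
    · exact (hg.comp (continuous_fst.comp continuous_fst)).inv
    · exact hg.comp (continuous_snd.comp continuous_fst)
  obtain ⟨δ, hδ, hδK⟩ : ∃ δ > (0 : ℝ), ∀ x ∈ K, δ ≤ f x := by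
    rcases K.eq_empty_or_nonempty with h | h
    · exact ⟨1, one_pos, by simp [h]⟩
    · obtain ⟨x, hx, hmin⟩ := hK.exists_isMinOn h hf.continuousOn
      refine ⟨f x, ?_, fun y hy => hmin hy⟩
      refine norm_pos_iff.2 fun h0 => ?_
      have := htr _ _ _ hx.2.2 h0
      have h1 : ‖x.2‖ = 1 := by simpa using hx.2.1
      rw [this, norm_zero] at h1
      exact zero_ne_one h1
  refine ⟨min δ 1, lt_min hδ one_pos, min_le_right _ _, fun s t y hy => ?_⟩
  rcases eq_or_ne y 0 with rfl | hy0
  · simp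
  have hn : 0 < ‖y‖ := norm_pos_iff.2 hy0
  have h1 := hδK ((s, t), ‖y‖⁻¹ • y) ⟨Set.mem_univ _, by
    simp [norm_smul, hn.ne'], by simp [hy]⟩
  have h2 : f ((s, t), ‖y‖⁻¹ • y) = ‖y‖⁻¹ * ‖p (glEquiv (g s)⁻¹ (glEquiv (g t) y))‖ := by
    simp [f, norm_smul]
  rw [h2, inv_mul_eq_div, le_div_iff₀ hn] at h1
  exact (mul_le_mul_of_nonneg_right (min_le_left _ _) hn.le).trans h1

theorem exists_norm_bound [TopologicalSpace ι] [CompactSpace ι] {g : ι → GL (Fin d) ℝ}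
    (hg : Continuous g) : ∃ C : ℝ, 1 ≤ C ∧ (∀ t, ‖(g t : Matrix (Fin d) (Fin d) ℝ)‖ ≤ C) ∧
      ∀ t, ‖((g t)⁻¹ : GL (Fin d) ℝ).val‖ ≤ C := by
  obtain ⟨C₁, h₁⟩ := isCompact_univ.exists_bound_of_continuousOn
    (Units.continuous_val.comp hg).continuousOn
  obtain ⟨C₂, h₂⟩ := isCompact_univ.exists_bound_of_continuousOn
    (Units.continuous_val.comp hg.inv).continuousOn
  exact ⟨max 1 (max C₁ C₂), le_max_left _ _,
    fun t => (h₁ t (Set.mem_univ t)).trans ((le_max_left _ _).trans (le_max_right _ _)),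
    fun t => (h₂ t (Set.mem_univ t)).trans ((le_max_right _ _).trans (le_max_right _ _))⟩

/-- The action of a matrix on Euclidean space. -/
def matAct (M : Matrix (Fin d) (Fin d) ℝ) : RVec d →L[ℝ] RVec d :=
  Matrix.toEuclideanCLM (n := Fin d) (𝕜 := ℝ) M

theorem norm_matAct_le (M : Matrix (Fin d) (Fin d) ℝ) (v : RVec d) :
    ‖matAct M v‖ ≤ ‖M‖ * ‖v‖ := by
  rw [← Matrix.l2_opNorm_toEuclideanCLM]
  exact ContinuousLinearMap.le_opNorm _ _

theorem glEquiv_eq_matAct (M : GL (Fin d) ℝ) (v : RVec d) :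
    glEquiv M v = matAct (M : Matrix (Fin d) (Fin d) ℝ) v :=
  rfl

theorem matAct_mul (M N : Matrix (Fin d) (Fin d) ℝ) (v : RVec d) :
    matAct (M * N) v = matAct M (matAct N v) := by
  rw [matAct, map_mul]; rfl

theorem matAct_add (M N : Matrix (Fin d) (Fin d) ℝ) (v : RVec d) :
    matAct (M + N) v = matAct M v + matAct N v := by
  rw [matAct, map_add]; rfl

theorem matAct_sub (M N : Matrix (Fin d) (Fin d) ℝ) (v : RVec d) :
    matAct (M - N) v = matAct M v - matAct N v := by
  rw [matAct, map_sub]; rfl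

theorem matAct_smul (c : ℝ) (M : Matrix (Fin d) (Fin d) ℝ) (v : RVec d) :
    matAct (c • M) v = c • matAct M v := by
  rw [matAct, map_smul]; rfl

theorem matAct_one (v : RVec d) : matAct (1 : Matrix (Fin d) (Fin d) ℝ) v = v := by
  rw [matAct, map_one]; rfl

theorem matAct_zero (v : RVec d) : matAct (0 : Matrix (Fin d) (Fin d) ℝ) v = 0 := by
  rw [matAct, map_zero]; rfl

theorem matAct_apply (M : Matrix (Fin d) (Fin d) ℝ) (v : RVec d) (k : Fin d) :
    matAct M v k = ∑ l, M k l * v l := rfl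

end Cone

/-! ### The two coordinate planes -/

section CoordinatePlanes

/-- The projection of `ℝ⁴` to its first two coordinates. -/
def headProj : Matrix (Fin 4) (Fin 4) ℝ := Matrix.diagonal ![1, 1, 0, 0]

/-- The projection of `ℝ⁴` to its last two coordinates. -/
def tailProj : Matrix (Fin 4) (Fin 4) ℝ := Matrix.diagonal ![0, 0, 1, 1]

theorem headProj_eq : headProj = !![1, 0, 0, 0; 0, 1, 0, 0; 0, 0, 0, 0; 0, 0, 0, 0] := by
  ext k l
  fin_cases k <;> fin_cases l <;> simp [headProj]

theorem tailProj_eq : tailProj = !![0, 0, 0, 0; 0, 0, 0, 0; 0, 0, 1, 0; 0, 0, 0, 1] := by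
  ext k l
  fin_cases k <;> fin_cases l <;> simp [tailProj]

theorem headProj_mul_tailProj : headProj * tailProj = 0 := by
  rw [headProj, tailProj, Matrix.diagonal_mul_diagonal, ← Matrix.diagonal_zero]
  congr 1
  ext k
  fin_cases k <;> simp

theorem tailProj_mul_headProj : tailProj * headProj = 0 := by
  rw [headProj, tailProj, Matrix.diagonal_mul_diagonal, ← Matrix.diagonal_zero]
  congr 1
  ext k
  fin_cases k <;> simp

theorem headProj_add_tailProj : headProj + tailProj = 1 := by
  rw [headProj, tailProj, Matrix.diagonal_add, ← Matrix.diagonal_one]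
  congr 1
  ext k
  fin_cases k <;> simp

theorem headProj_mul_self : headProj * headProj = headProj := by
  have : headProj * (headProj + tailProj) = headProj := by rw [headProj_add_tailProj, mul_one]
  rwa [mul_add, headProj_mul_tailProj, add_zero] at this

theorem tailProj_mul_self : tailProj * tailProj = tailProj := by
  have : tailProj * (headProj + tailProj) = tailProj := by rw [headProj_add_tailProj, mul_one]
  rwa [mul_add, tailProj_mul_headProj, zero_add] at this

theorem norm_headProj_le : ‖headProj‖ ≤ 1 := by
  rw [headProj, Matrix.l2_opNorm_diagonal, pi_norm_le_iff_of_nonneg zero_le_one]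
  intro k
  fin_cases k <;> simp

theorem norm_tailProj_le : ‖tailProj‖ ≤ 1 := by
  rw [tailProj, Matrix.l2_opNorm_diagonal, pi_norm_le_iff_of_nonneg zero_le_one]
  intro k
  fin_cases k <;> simp

theorem matAct_headProj_eq_self_iff (v : RVec 4) : matAct headProj v = v ↔ v 2 = 0 ∧ v 3 = 0 := by
  constructor
  · intro h
    constructor <;> (rw [← h, matAct_apply]; simp [Fin.sum_univ_four, headProj])
  · rintro ⟨h2, h3⟩
    ext k
    rw [matAct_apply]
    fin_cases k <;> simp [Fin.sum_univ_four, headProj, h2, h3]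

theorem matAct_tailProj_eq_self_iff (v : RVec 4) : matAct tailProj v = v ↔ v 0 = 0 ∧ v 1 = 0 := by
  constructor
  · intro h
    constructor <;> (rw [← h, matAct_apply]; simp [Fin.sum_univ_four, tailProj])
  · rintro ⟨h2, h3⟩
    ext k
    rw [matAct_apply]
    fin_cases k <;> simp [Fin.sum_univ_four, tailProj, h2, h3]

theorem exists_grass_eq_range {k l : Fin 4} (hkl : k ≠ l) :
    ∃ P : Grass 2 4, ∀ v : RVec 4, v ∈ P.1 ↔ ∀ m, m ≠ k → m ≠ l → v m = 0 := by
  have hLI : LinearIndependent ℝ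
      ![EuclideanSpace.single k (1 : ℝ), EuclideanSpace.single l (1 : ℝ)] := by
    rw [LinearIndependent.pair_iff]
    intro s t h
    have hk := congrArg (fun v : RVec 4 => v k) h
    have hl := congrArg (fun v : RVec 4 => v l) h
    simp [hkl, hkl.symm] at hk hl
    exact ⟨hk, hl⟩
  refine ⟨spanFrame ⟨_, hLI⟩, fun v => ?_⟩
  change v ∈ Submodule.span ℝ (Set.range
    ![EuclideanSpace.single k (1 : ℝ), EuclideanSpace.single l (1 : ℝ)]) ↔ _
  rw [Matrix.range_cons, Matrix.range_cons, Matrix.range_empty, Set.union_empty,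
    Set.singleton_union, Submodule.mem_span_pair]
  constructor
  · rintro ⟨a, b, rfl⟩ m hk hl
    simp [hk, hl]
  · intro h
    refine ⟨v k, v l, ?_⟩
    ext m
    by_cases hk : m = k
    · subst hk; simp [hkl]
    · by_cases hl : m = l
      · subst hl; simp [hkl.symm]
      · simp [hk, hl, h m hk hl]

theorem exists_headPlane : ∃ P : Grass 2 4, ∀ v, v ∈ P.1 ↔ matAct headProj v = v := by
  obtain ⟨P, hP⟩ := exists_grass_eq_range (k := 0) (l := 1) (by decide)
  refine ⟨P, fun v => ?_⟩
  rw [hP, matAct_headProj_eq_self_iff]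
  constructor
  · exact fun h => ⟨h 2 (by decide) (by decide), h 3 (by decide) (by decide)⟩
  · rintro ⟨h2, h3⟩ m h h'
    fin_cases m
    · exact absurd rfl h
    · exact absurd rfl h'
    · exact h2
    · exact h3

theorem exists_tailPlane : ∃ Q : Grass 2 4, ∀ v, v ∈ Q.1 ↔ matAct tailProj v = v := by
  obtain ⟨P, hP⟩ := exists_grass_eq_range (k := 2) (l := 3) (by decide)
  refine ⟨P, fun v => ?_⟩
  rw [hP, matAct_tailProj_eq_self_iff]
  constructor
  · exact fun h => ⟨h 0 (by decide) (by decide), h 1 (by decide) (by decide)⟩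
  · rintro ⟨h2, h3⟩ m h h'
    fin_cases m
    · exact h2
    · exact h3
    · exact absurd rfl h
    · exact absurd rfl h'

theorem glMap_eq_of_mul_eq {i d : ℕ} {p X : Matrix (Fin d) (Fin d) ℝ} (hp : p * p = p)
    {P : Grass i d} (hP : ∀ v, v ∈ P.1 ↔ matAct p v = v) {B h : GL (Fin d) ℝ}
    (hX : (B : Matrix (Fin d) (Fin d) ℝ) * (h * p) = h * p * X) :
    glMap B (glMap h P) = glMap h P := by
  apply Subtype.ext
  refine Submodule.eq_of_le_of_finrank_eq ?_ (by rw [(glMap B _).2, (glMap h P).2])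
  rintro _ ⟨_, ⟨y, hy, rfl⟩, rfl⟩
  have hy' := (hP y).1 hy
  have h1 : glEquiv B (glEquiv h y) = glEquiv h (matAct p (matAct X y)) := by
    simp only [glEquiv_eq_matAct]
    have := congrArg (fun M => matAct M y) hX
    simp only [matAct_mul, hy'] at this
    exact this
  change glEquiv B (glEquiv h y) ∈ _
  rw [h1]
  exact apply_mem_glMap h ((hP _).2 (by rw [← matAct_mul, hp]))

end CoordinatePlanes

/-! ### Lines meeting four planes as zeros of a determinant -/

section CrossingLine

/-- The exchange of the first two coordinates of `ℝ⁴` with the last two. -/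
def swapMat : Matrix (Fin 4) (Fin 4) ℝ := !![0, 0, 1, 0; 0, 0, 0, 1; 1, 0, 0, 0; 0, 1, 0, 0]

theorem swapMat_mul_self : swapMat * swapMat = 1 := by
  ext k l
  fin_cases k <;> fin_cases l <;> simp [swapMat, Matrix.mul_apply, Fin.sum_univ_four]

theorem swapMat_mul_headProj : swapMat * headProj = tailProj * swapMat := by
  ext k l
  fin_cases k <;> fin_cases l <;>
    simp [swapMat, headProj, tailProj]

theorem swapMat_mul_tailProj : swapMat * tailProj = headProj * swapMat := by
  ext k l
  fin_cases k <;> fin_cases l <;>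
    simp [swapMat, headProj, tailProj]

/-- The columns of this matrix span the images of the first coordinate plane by `M` and `N`. -/
def joinMat (M N : Matrix (Fin 4) (Fin 4) ℝ) : Matrix (Fin 4) (Fin 4) ℝ :=
  M * headProj + N * swapMat * tailProj

/-- A matrix that is singular if some projective line meets the four images of the coordinate
planes by `M` and `N` with a cross-ratio that is determined by `μ`. -/
def crossingMat (μ : ℝ) (M N : Matrix (Fin 4) (Fin 4) ℝ) : Matrix (Fin 4) (Fin 4) ℝ :=
  joinMat M N * (headProj + μ • tailProj) * (joinMat M N).adjugate * M * swapMat * headProj +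
    (joinMat M N).det • (N * tailProj)

/-- With J = `joinMat M N`, a vector My determines x and x' by My = Mx + Nx', and then Mx + μNx' =
J(p + μq)J⁻¹My, where p and q are the coordinate projections. It lies in the second image of the
tail plane exactly when it equals some Ny'. A kernel vector of `crossingMat` encodes y in its head
and y' in its tail; the adjugate replaces J⁻¹ to keep the entries polynomial. If y were 0,
invertibility of N would make the whole kernel vector vanish. -/
theorem exists_crossing_of_det_eq_zero {M N : Matrix (Fin 4) (Fin 4) ℝ}
    (hN : N.det ≠ 0) (hJ : (joinMat M N).det ≠ 0) {μ : ℝ} (hdet : (crossingMat μ M N).det = 0) :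
    ∃ x x' y y' : RVec 4, matAct headProj x = x ∧ matAct headProj x' = x' ∧
      matAct tailProj y = y ∧ matAct tailProj y' = y' ∧ y ≠ 0 ∧
      matAct M x + matAct N x' = matAct M y ∧ matAct M x + μ • matAct N x' = matAct N y' := by
  obtain ⟨u₀, hu₀, hker₀⟩ := Matrix.exists_mulVec_eq_zero_iff.2 hdet
  set J := joinMat M N with hJdef
  set u : RVec 4 := WithLp.toLp 2 u₀ with hu
  have hker : matAct (crossingMat μ M N) u = 0 := by
    ext k
    exact congrFun hker₀ k
  have hu0 : u ≠ 0 := by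
    intro h
    exact hu₀ (by simpa [hu] using h)
  have hinj : ∀ {K : Matrix (Fin 4) (Fin 4) ℝ}, K.det ≠ 0 →
      ∀ {v : RVec 4}, matAct K v = 0 → v = 0 := by
    intro K hK v hv
    have h1 : matAct (K.adjugate * K) v = 0 := by rw [matAct_mul, hv, map_zero]
    rw [Matrix.adjugate_mul, matAct_smul, matAct_one] at h1
    exact (smul_eq_zero.1 h1).resolve_left hK
  set y₀ := matAct swapMat (matAct headProj u) with hy₀
  set z := matAct J.adjugate (matAct M y₀) with hz
  have hJz : matAct J z = J.det • matAct M y₀ := by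
    rw [hz, ← matAct_mul, Matrix.mul_adjugate, matAct_smul, matAct_one]
  have hsplit : ∀ v, matAct J v = matAct M (matAct headProj v) +
      matAct N (matAct swapMat (matAct tailProj v)) := by
    intro v
    rw [hJdef, joinMat, matAct_add, matAct_mul, matAct_mul, matAct_mul]
  have hker' : matAct M (matAct headProj z) + μ • matAct N (matAct swapMat (matAct tailProj z)) =
      matAct N (-(J.det • matAct tailProj u)) := by
    have h1 : matAct J (matAct (headProj + μ • tailProj) z) +
        J.det • matAct N (matAct tailProj u) = 0 := by
      rw [← hker, crossingMat]
      simp only [matAct_add, matAct_smul, matAct_mul, ← hJdef, hz, hy₀, map_add, map_smul]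
    rw [hsplit, matAct_add, matAct_smul] at h1
    simp only [map_add, map_smul, ← matAct_mul headProj, ← matAct_mul tailProj, headProj_mul_self,
      tailProj_mul_self, headProj_mul_tailProj, tailProj_mul_headProj] at h1
    rw [map_neg, map_smul, ← add_eq_zero_iff_eq_neg, ← h1]
    simp only [matAct_zero, map_zero, zero_add, add_zero, smul_zero]
  refine ⟨matAct headProj z, matAct swapMat (matAct tailProj z), J.det • y₀,
    -(J.det • matAct tailProj u), ?_, ?_, ?_, ?_, ?_, ?_, hker'⟩
  · rw [← matAct_mul, headProj_mul_self]
  · have : headProj * (swapMat * tailProj) = swapMat * tailProj := by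
      rw [swapMat_mul_tailProj, ← mul_assoc, headProj_mul_self]
    simpa only [matAct_mul] using congrArg (fun K => matAct K z) this
  · have : tailProj * (swapMat * headProj) = swapMat * headProj := by
      rw [swapMat_mul_headProj, ← mul_assoc, tailProj_mul_self]
    rw [map_smul, hy₀]
    congr 1
    simpa only [matAct_mul] using congrArg (fun K => matAct K u) this
  · rw [map_neg, map_smul, ← matAct_mul, tailProj_mul_self]
  · intro h
    have hy00 : y₀ = 0 := (smul_eq_zero.1 h).resolve_left hJ
    have hpu : matAct headProj u = 0 := by
      rw [← matAct_one (matAct headProj u), ← swapMat_mul_self, matAct_mul, ← hy₀, hy00, map_zero]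
    have hz0 : z = 0 := by rw [hz, hy00, map_zero, map_zero]
    rw [hz0] at hker'
    simp only [map_zero, smul_zero, add_zero] at hker'
    have h1 := hinj hN hker'.symm
    have hqu : matAct tailProj u = 0 := (smul_eq_zero.1 (neg_eq_zero.1 h1)).resolve_left hJ
    apply hu0
    rw [← matAct_one u, ← headProj_add_tailProj, matAct_add, hpu, hqu, add_zero]
  · rw [← hsplit, hJz, map_smul]

section Continuity

variable {X : Type*} [TopologicalSpace X] {f : X → ℝ} {M N : X → Matrix (Fin 4) (Fin 4) ℝ}

theorem continuous_joinMat (hM : Continuous M) (hN : Continuous N) :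
    Continuous fun x => joinMat (M x) (N x) := by
  unfold joinMat
  fun_prop

theorem continuous_crossingMat (hf : Continuous f) (hM : Continuous M) (hN : Continuous N) :
    Continuous fun x => crossingMat (f x) (M x) (N x) := by
  have hJ := continuous_joinMat hM hN
  have hA := hJ.matrix_adjugate
  have hD := hJ.matrix_det
  unfold crossingMat
  fun_prop

end Continuity

end CrossingLine

/-! ### The explicit path -/

section Example

/-- The first two columns of this matrix span the expanded plane, and the last two columns the
contracted plane, of the matrix with parameter `t`. -/
def frameMat (t : ℝ) : Matrix (Fin 4) (Fin 4) ℝ :=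
  !![1, 0, 2 * t, -(2 * t * (1 - t)); 0, 1, 2 * t * (1 - t), 3 * t;
    Real.cos (Real.pi * t), -Real.sin (Real.pi * t), 1, 0;
    Real.sin (Real.pi * t), Real.cos (Real.pi * t), 0, 1]

/-- The expression is det(1 - T_u R_t). As sin(πt) and b = 2u(1-u) are non-negative, the worst case
is cos = 1, sin = 0, which leaves (2u - 1)(3u - 1) + b². The first term is at least -1/24, and it is
non-positive only on [1/3, 1/2], where b ≥ 4/9. Without the skew entries ±b positivity would fail
there. -/
theorem transversality_det_pos {u t : ℝ} (hu0 : 0 ≤ u) (hu1 : u ≤ 1) (ht0 : 0 ≤ t) (ht1 : t ≤ 1) :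
    0 < 1 - 5 * u * Real.cos (Real.pi * t) +
      2 * Real.sin (Real.pi * t) * (2 * u * (1 - u)) + 6 * u ^ 2 + (2 * u * (1 - u)) ^ 2 := by
  have hs : 0 ≤ Real.sin (Real.pi * t) :=
    Real.sin_nonneg_of_nonneg_of_le_pi (by positivity) (by nlinarith [Real.pi_pos])
  have hc : Real.cos (Real.pi * t) ≤ 1 := Real.cos_le_one _
  have hb : 0 ≤ 2 * u * (1 - u) := mul_nonneg (by linarith) (by linarith)
  have h1 : 0 ≤ u * (1 - Real.cos (Real.pi * t)) := mul_nonneg hu0 (by linarith)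
  have h2 := mul_nonneg hs hb
  have h3 : 0 < (2 * u - 1) * (3 * u - 1) + (2 * u * (1 - u)) ^ 2 := by
    by_cases h : 1 / 3 ≤ u ∧ u ≤ 1 / 2
    · obtain ⟨h4, h5⟩ := h
      have h6 : 4 / 9 ≤ 2 * u * (1 - u) := by nlinarith
      nlinarith [sq_nonneg (u - 5 / 12)]
    · have h7 : 0 < (2 * u - 1) * (3 * u - 1) := by
        by_cases h8 : u < 1 / 3
        · nlinarith
        · have : 1 / 2 < u := by
            by_contra! h9
            exact h ⟨by linarith, h9⟩
          nlinarith
      positivity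
  nlinarith

theorem det_frameMat_ne_zero {t : ℝ} (ht0 : 0 ≤ t) (ht1 : t ≤ 1) : (frameMat t).det ≠ 0 := by
  have h := transversality_det_pos ht0 ht1 ht0 ht1
  have h1 := Real.sin_sq_add_cos_sq (Real.pi * t)
  have h2 : (frameMat t).det = 1 - 5 * t * Real.cos (Real.pi * t) +
      2 * Real.sin (Real.pi * t) * (2 * t * (1 - t)) + 6 * t ^ 2 + (2 * t * (1 - t)) ^ 2 := by
    rw [frameMat]
    simp [Matrix.det_succ_row_zero, Fin.sum_univ_succ, Fin.succAbove]
    linear_combination (6 * t ^ 2 + (2 * t * (1 - t)) ^ 2) * h1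
  rw [h2]
  exact h.ne'

theorem continuous_frameMat : Continuous frameMat := by
  refine continuous_matrix fun k l => ?_
  unfold frameMat
  fin_cases k <;> fin_cases l <;> simp <;> fun_prop

/-- The path `frameMat`, in the general linear group. -/
def framePath : C(unitInterval, GL (Fin 4) ℝ) where
  toFun t := Matrix.GeneralLinearGroup.mkOfDetNeZero (frameMat t) (det_frameMat_ne_zero t.2.1 t.2.2)
  continuous_toFun := by
    rw [Units.isOpenEmbedding_val.isEmbedding.continuous_iff]
    exact continuous_frameMat.comp continuous_subtype_val

/-- A violation would be a non-zero vector of E_t ∩ F_s, that is, a kernel vector of 1 - T_s R_t. -/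
theorem framePath_transverse_head (s t : unitInterval) (y : RVec 4) (hy : matAct headProj y = y)
    (h : matAct headProj (glEquiv (framePath s)⁻¹ (glEquiv (framePath t) y)) = 0) : y = 0 := by
  set w := glEquiv (framePath s)⁻¹ (glEquiv (framePath t) y) with hw
  have hgw : glEquiv (framePath s) w = glEquiv (framePath t) y := by
    rw [hw, glEquiv_apply_inv_self]
  obtain ⟨hy2, hy3⟩ := (matAct_headProj_eq_self_iff y).1 hy
  have hw' : matAct tailProj w = w := by
    nth_rw 2 [← matAct_one w]
    rw [← headProj_add_tailProj, matAct_add, h, zero_add]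
  obtain ⟨hw0, hw1⟩ := (matAct_tailProj_eq_self_iff w).1 hw'
  have hk : ∀ k, matAct (frameMat s) w k = matAct (frameMat t) y k := fun k =>
    congrArg (fun v : RVec 4 => v k) hgw
  have e0 := hk 0
  have e1 := hk 1
  have e2 := hk 2
  have e3 := hk 3
  simp [matAct_apply, Fin.sum_univ_four, frameMat, hy2, hy3, hw0, hw1] at e0 e1 e2 e3
  have hD := (transversality_det_pos s.2.1 s.2.2 t.2.1 t.2.2).ne'
  have hcs := Real.sin_sq_add_cos_sq (Real.pi * t)
  set c := Real.cos (Real.pi * t)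
  set σ := Real.sin (Real.pi * t)
  rw [e2, e3] at e0 e1
  have h0 : y 0 = 0 := by
    refine (mul_eq_zero.1 (?_ : _ * y 0 = 0)).resolve_left hD
    -- Cramer's rule for 1 - T_s R_t: the coefficients are entries of its adjugate up to sign, and
    -- the last term uses cos² + sin² = 1.
    linear_combination -(1 - (3 * (s : ℝ) * c - 2 * (s : ℝ) * (1 - (s : ℝ)) * σ)) * e0 +
      (2 * (s : ℝ) * σ + 2 * (s : ℝ) * (1 - (s : ℝ)) * c) * e1 -
      (6 * (s : ℝ) ^ 2 + (2 * (s : ℝ) * (1 - (s : ℝ))) ^ 2) * y 0 * hcs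
  have h1 : y 1 = 0 := by
    refine (mul_eq_zero.1 (?_ : _ * y 1 = 0)).resolve_left hD
    linear_combination -(1 - (2 * (s : ℝ) * c - 2 * (s : ℝ) * (1 - (s : ℝ)) * σ)) * e1 -
      (3 * (s : ℝ) * σ + 2 * (s : ℝ) * (1 - (s : ℝ)) * c) * e0 -
      (6 * (s : ℝ) ^ 2 + (2 * (s : ℝ) * (1 - (s : ℝ))) ^ 2) * y 1 * hcs
  ext k
  fin_cases k
  exacts [h0, h1, hy2, hy3]

theorem framePath_transverse_tail (s t : unitInterval) (y : RVec 4) (hy : matAct tailProj y = y)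
    (h : matAct tailProj (glEquiv (framePath s)⁻¹ (glEquiv (framePath t) y)) = 0) : y = 0 := by
  set w := glEquiv (framePath s)⁻¹ (glEquiv (framePath t) y) with hw
  have hgw : glEquiv (framePath s) w = glEquiv (framePath t) y := by
    rw [hw, glEquiv_apply_inv_self]
  obtain ⟨hy0, hy1⟩ := (matAct_tailProj_eq_self_iff y).1 hy
  have hw' : matAct headProj w = w := by
    nth_rw 2 [← matAct_one w]
    rw [← headProj_add_tailProj, matAct_add, h, add_zero]
  obtain ⟨hw2, hw3⟩ := (matAct_headProj_eq_self_iff w).1 hw'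
  have hk : ∀ k, matAct (frameMat s) w k = matAct (frameMat t) y k := fun k =>
    congrArg (fun v : RVec 4 => v k) hgw
  have e0 := hk 0
  have e1 := hk 1
  have e2 := hk 2
  have e3 := hk 3
  simp [matAct_apply, Fin.sum_univ_four, frameMat, hy0, hy1, hw2, hw3] at e0 e1 e2 e3
  have hD := (transversality_det_pos t.2.1 t.2.2 s.2.1 s.2.2).ne'
  have hcs := Real.sin_sq_add_cos_sq (Real.pi * s)
  set c := Real.cos (Real.pi * s)
  set σ := Real.sin (Real.pi * s)
  rw [e0, e1] at e2 e3
  have h2 : y 2 = 0 := by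
    refine (mul_eq_zero.1 (?_ : _ * y 2 = 0)).resolve_left hD
    linear_combination -(1 - (3 * (t : ℝ) * c - 2 * (t : ℝ) * (1 - (t : ℝ)) * σ)) * e2 +
      (3 * (t : ℝ) * σ + 2 * (t : ℝ) * (1 - (t : ℝ)) * c) * e3 -
      (6 * (t : ℝ) ^ 2 + (2 * (t : ℝ) * (1 - (t : ℝ))) ^ 2) * y 2 * hcs
  have h3 : y 3 = 0 := by
    refine (mul_eq_zero.1 (?_ : _ * y 3 = 0)).resolve_left hD
    linear_combination -(1 - (2 * (t : ℝ) * c - 2 * (t : ℝ) * (1 - (t : ℝ)) * σ)) * e3 -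
      (2 * (t : ℝ) * σ + 2 * (t : ℝ) * (1 - (t : ℝ)) * c) * e2 -
      (6 * (t : ℝ) ^ 2 + (2 * (t : ℝ) * (1 - (t : ℝ))) ^ 2) * y 3 * hcs
  ext k
  fin_cases k
  exacts [hy0, hy1, h2, h3]

theorem joinMat_frameMat : joinMat (frameMat 0) (frameMat 1) =
    !![1, 0, 1, 0; 0, 1, 0, 1; 1, 0, -1, 0; 0, 1, 0, -1] := by
  ext k l
  fin_cases k <;> fin_cases l <;>
    simp [joinMat, frameMat, swapMat, headProj_eq, tailProj_eq]

theorem det_joinMat_frameMat : (joinMat (frameMat 0) (frameMat 1)).det = 4 := by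
  rw [joinMat_frameMat]
  simp [Matrix.det_succ_row_zero, Fin.sum_univ_succ, Fin.succAbove]
  norm_num

/-- The matrix J satisfies J² = 2 and det J = 4, so its adjugate is 4J⁻¹ = 2J. -/
theorem adjugate_joinMat_frameMat : (joinMat (frameMat 0) (frameMat 1)).adjugate =
    (2 : ℝ) • joinMat (frameMat 0) (frameMat 1) := by
  have h1 : joinMat (frameMat 0) (frameMat 1) * joinMat (frameMat 0) (frameMat 1) = (2 : ℝ) • 1 := by
    rw [joinMat_frameMat]
    ext k l
    fin_cases k <;> fin_cases l <;>
      simp [Matrix.mul_apply, Fin.sum_univ_four] <;> norm_num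
  have h2 := Matrix.adjugate_mul (joinMat (frameMat 0) (frameMat 1))
  have h3 := congrArg (fun K => K * joinMat (frameMat 0) (frameMat 1)) h2
  simp only [mul_assoc, h1, det_joinMat_frameMat, mul_smul_comm, mul_one, smul_mul_assoc,
    one_mul] at h3
  have h4 := congrArg (fun K => (2⁻¹ : ℝ) • K) h3
  simp only [smul_smul] at h4
  norm_num at h4
  exact h4

/-- The problem splits into the planes of axes 1, 3 and of axes 2, 4, where F_1 has slopes 1/2 and
1/3. The roots are μ = -1/3 and μ = -1/2. -/
theorem det_crossingMat_frameMat (μ : ℝ) : (crossingMat μ (frameMat 0) (frameMat 1)).det =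
    64 * ((1 - μ) - 2 * (1 + μ)) * ((1 - μ) - 3 * (1 + μ)) := by
  have : crossingMat μ (frameMat 0) (frameMat 1) =
      !![2 * (1 - μ), 0, 8, 0; 0, 2 * (1 - μ), 0, 12; 2 * (1 + μ), 0, 4, 0;
        0, 2 * (1 + μ), 0, 4] := by
    rw [crossingMat, adjugate_joinMat_frameMat, det_joinMat_frameMat, joinMat_frameMat]
    ext k l
    fin_cases k <;> fin_cases l <;>
      simp [frameMat, swapMat, headProj_eq, tailProj_eq] <;> ring
  rw [this]
  simp [Matrix.det_succ_row_zero, Fin.sum_univ_succ, Fin.succAbove]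
  ring

theorem eventually_exists_crossing :
    ∀ᶠ z : Matrix (Fin 4) (Fin 4) ℝ × Matrix (Fin 4) (Fin 4) ℝ in 𝓝 (frameMat 0, frameMat 1),
      z.1.det ≠ 0 ∧ z.2.det ≠ 0 ∧ ∃ μ < (0 : ℝ), ∃ x x' y y' : RVec 4,
        matAct headProj x = x ∧ matAct headProj x' = x' ∧
        matAct tailProj y = y ∧ matAct tailProj y' = y' ∧ y ≠ 0 ∧
        matAct z.1 x + matAct z.2 x' = matAct z.1 y ∧
        matAct z.1 x + μ • matAct z.2 x' = matAct z.2 y' := by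
  have hdet : ∀ μ : ℝ, Continuous fun z : Matrix (Fin 4) (Fin 4) ℝ × Matrix (Fin 4) (Fin 4) ℝ =>
      (crossingMat μ z.1 z.2).det := fun μ =>
    (continuous_crossingMat continuous_const continuous_fst continuous_snd).matrix_det
  have hd₁ : Continuous fun z : Matrix (Fin 4) (Fin 4) ℝ × Matrix (Fin 4) (Fin 4) ℝ => z.1.det :=
    continuous_fst.matrix_det
  have hd₂ : Continuous fun z : Matrix (Fin 4) (Fin 4) ℝ × Matrix (Fin 4) (Fin 4) ℝ => z.2.det :=
    continuous_snd.matrix_det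
  have hg₁ : (frameMat 0).det ≠ 0 := det_frameMat_ne_zero le_rfl zero_le_one
  have hg₂ : (frameMat 1).det ≠ 0 := det_frameMat_ne_zero zero_le_one le_rfl
  have hg₃ : (joinMat (frameMat 0) (frameMat 1)).det ≠ 0 := by
    rw [det_joinMat_frameMat]; norm_num
  -- The points -1 and -2/5 enclose the simple root -1/2 only, so the determinant changes sign
  -- between them, and it still does for nearby matrices.
  have hg₄ : 0 < (crossingMat (-1) (frameMat 0) (frameMat 1)).det := by
    rw [det_crossingMat_frameMat]; norm_num
  have hg₅ : (crossingMat (-2 / 5) (frameMat 0) (frameMat 1)).det < 0 := by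
    rw [det_crossingMat_frameMat]; norm_num
  have h1 := (isOpen_ne_fun hd₁ continuous_const).mem_nhds (x := (frameMat 0, frameMat 1)) hg₁
  have h2 := (isOpen_ne_fun hd₂ continuous_const).mem_nhds (x := (frameMat 0, frameMat 1)) hg₂
  have h3 := (isOpen_ne_fun (continuous_joinMat continuous_fst continuous_snd).matrix_det
    continuous_const).mem_nhds (x := (frameMat 0, frameMat 1)) hg₃
  have h4 := (isOpen_lt continuous_const (hdet (-1))).mem_nhds
    (x := (frameMat 0, frameMat 1)) hg₄
  have h5 := (isOpen_lt (hdet (-2 / 5)) continuous_const).mem_nhds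
    (x := (frameMat 0, frameMat 1)) hg₅
  filter_upwards [h1, h2, h3, h4, h5] with z hz1 hz2 hz3 hz4 hz5
  refine ⟨hz1, hz2, ?_⟩
  have hc : Continuous fun μ : ℝ => (crossingMat μ z.1 z.2).det :=
    (continuous_crossingMat continuous_id continuous_const continuous_const).matrix_det
  obtain ⟨μ, hμ, hμ0⟩ := intermediate_value_Icc' (a := (-1 : ℝ)) (b := -2 / 5) (by norm_num)
    hc.continuousOn ⟨hz5.le, hz4.le⟩
  exact ⟨μ, by linarith [hμ.2], exists_crossing_of_det_eq_zero hz2 hz3 hμ0⟩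

end Example

/-! ### Choice of constants and stability under perturbation -/

section Perturbation

/-- The hyperbolic diagonal matrix with double eigenvalues `l` and `l⁻¹`. -/
def hyperbolicDiag (l : ℝ) (hl : l ≠ 0) : GL (Fin 4) ℝ where
  val := l • headProj + l⁻¹ • tailProj
  inv := l • tailProj + l⁻¹ • headProj
  val_inv := by
    simp only [add_mul, mul_add, smul_mul_smul_comm, headProj_mul_self, tailProj_mul_self,
      headProj_mul_tailProj, tailProj_mul_headProj, smul_zero, mul_inv_cancel₀ hl,
      inv_mul_cancel₀ hl, one_smul, zero_add, add_zero]
    rw [add_comm, headProj_add_tailProj]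
  inv_val := by
    simp only [add_mul, mul_add, smul_mul_smul_comm, headProj_mul_self, tailProj_mul_self,
      headProj_mul_tailProj, tailProj_mul_headProj, smul_zero, mul_inv_cancel₀ hl,
      inv_mul_cancel₀ hl, one_smul, zero_add, add_zero]
    exact headProj_add_tailProj

theorem exists_conj_block {C δ l : ℝ} {g B : GL (Fin 4) ℝ}
    (hg : ‖(g : Matrix (Fin 4) (Fin 4) ℝ)‖ ≤ C) (hl : 2 ≤ l) (hδ0 : 0 ≤ δ) (hδ1 : δ ≤ 1)
    (hB : ‖((g⁻¹ * B * g : GL (Fin 4) ℝ) : Matrix (Fin 4) (Fin 4) ℝ) -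
      (l • headProj + l⁻¹ • tailProj)‖ ≤ δ / 8) :
    ∃ h X Y : Matrix (Fin 4) (Fin 4) ℝ, ‖h - g‖ ≤ C * (2 * δ) ∧
      (B : Matrix (Fin 4) (Fin 4) ℝ) * (h * headProj) = h * headProj * X ∧
      (B : Matrix (Fin 4) (Fin 4) ℝ) * (h * tailProj) = h * tailProj * Y := by
  have hl' : l⁻¹ ≤ 1 := inv_le_one_of_one_le₀ (by linarith)
  obtain ⟨h, X, Y, hh, hX, hY⟩ := exists_block_diagonalization headProj_mul_tailProj
    tailProj_mul_headProj headProj_add_tailProj norm_headProj_le norm_tailProj_le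
    (a := l) (b := l⁻¹) (by rw [abs_of_nonneg] <;> linarith) hδ0 hδ1 hB
  have hconj : (B : Matrix (Fin 4) (Fin 4) ℝ) * g =
      g * ((g⁻¹ * B * g : GL (Fin 4) ℝ) : Matrix (Fin 4) (Fin 4) ℝ) := by
    rw [← Units.val_mul, ← Units.val_mul]
    congr 1
    group
  refine ⟨g * h, X, Y, ?_, ?_, ?_⟩
  · have : (g : Matrix (Fin 4) (Fin 4) ℝ) * h - g = g * (h - 1) := by rw [mul_sub, mul_one]
    rw [this]
    refine (norm_mul_le _ _).trans ?_
    gcongr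
    exact (norm_nonneg _).trans hg
  · rw [← mul_assoc, ← mul_assoc, hconj, mul_assoc, mul_assoc, hX]
    simp only [mul_assoc]
  · rw [← mul_assoc, ← mul_assoc, hconj, mul_assoc, mul_assoc, hY]
    simp only [mul_assoc]

theorem mem_approxCone_of_mem_glMap {ι : Type*} {g : ι → GL (Fin 4) ℝ}
    {p : Matrix (Fin 4) (Fin 4) ℝ} {ε : ℝ} {P : Grass 2 4} (hP : ∀ v, v ∈ P.1 ↔ matAct p v = v)
    {h : GL (Fin 4) ℝ} {t : ι}
    (hh : ‖(h : Matrix (Fin 4) (Fin 4) ℝ) - (g t : Matrix (Fin 4) (Fin 4) ℝ)‖ ≤ ε) :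
    ∀ v ∈ (glMap h P).1, v ∈ approxCone g (matAct p) ε := by
  rintro _ ⟨y, hy, rfl⟩
  refine ⟨t, y, (hP y).1 hy, ?_⟩
  change ‖glEquiv h y - glEquiv (g t) y‖ ≤ _
  rw [glEquiv_eq_matAct, glEquiv_eq_matAct, ← matAct_sub]
  exact (norm_matAct_le _ _).trans (by gcongr)

theorem expandsCone_of_norm_sub_le {ι : Type*} {g B : ι → GL (Fin 4) ℝ}
    {p q : Matrix (Fin 4) (Fin 4) ℝ} (hpp : p * p = p) (hp : ‖p‖ ≤ 1) (hq : ‖q‖ ≤ 1)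
    {C δ l : ℝ} (hC : 1 ≤ C) (hg : ∀ t, ‖(g t : Matrix (Fin 4) (Fin 4) ℝ)‖ ≤ C)
    (hg' : ∀ t, ‖((g t)⁻¹ : GL (Fin 4) ℝ).val‖ ≤ C) (hδ : 0 < δ) (hδ1 : δ ≤ 1)
    (htr : ∀ s t y, matAct p y = y →
      δ * ‖y‖ ≤ ‖matAct p (glEquiv (g s)⁻¹ (glEquiv (g t) y))‖)
    (hl : 16 * C ^ 4 ≤ l * δ ^ 2)
    (hB : ∀ t, ‖((g t)⁻¹ * B t * g t : GL (Fin 4) ℝ).val - (l • p + l⁻¹ • q)‖ ≤ 1 / 2) :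
    ExpandsCone (Set.range B) (approxCone g (matAct p) (δ / (2 * C))) := by
  have hle : ∀ {K : Matrix (Fin 4) (Fin 4) ℝ} {c : ℝ}, ‖K‖ ≤ c → ∀ y, ‖matAct K y‖ ≤ c * ‖y‖ :=
    fun h y => (norm_matAct_le _ _).trans (by gcongr)
  refine expandsCone_approxCone (q := matAct q) (fun y => by rw [← matAct_mul, hpp])
    (fun y => by simpa using hle hp y) (fun y => by simpa using hle hq y) hC
    (fun t y => hle (hg t) y) (fun t y => hle (hg' t) y) hδ hδ1 htr hl fun t y => ?_
  have := hle (hB t) y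
  rwa [matAct_sub, matAct_add, matAct_smul, matAct_smul] at this

/-- The hypotheses of the main construction hold for all paths whose conjugates by `framePath` are
close to a hyperbolic diagonal matrix with large ratio of eigenvalues. -/
theorem exists_hasCrossing : ∃ l : ℝ, ∃ hl : l ≠ 0, ∃ η > (0 : ℝ),
    ∀ B : C(unitInterval, GL (Fin 4) ℝ),
      (∀ t, ‖((framePath t)⁻¹ * B t * framePath t : GL (Fin 4) ℝ).val -
        (hyperbolicDiag l hl).val‖ < η ∧
        ‖((framePath t)⁻¹ * B t * framePath t : GL (Fin 4) ℝ)⁻¹.val -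
        (hyperbolicDiag l hl)⁻¹.val‖ < η) →
      ∃ U U' E₀ E₁ F₀ F₁, HasCrossing B U U' E₀ E₁ F₀ F₁ := by
  obtain ⟨C, hC, hg, hg'⟩ := exists_norm_bound framePath.continuous
  obtain ⟨δ₁, hδ₁, hδ₁1, htr₁⟩ :=
    exists_transversality_bound framePath.continuous framePath_transverse_head
  obtain ⟨δ₂, hδ₂, hδ₂1, htr₂⟩ :=
    exists_transversality_bound framePath.continuous framePath_transverse_tail
  obtain ⟨ρ, hρ, hball⟩ := Metric.eventually_nhds_iff.1 eventually_exists_crossing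
  obtain ⟨P, hP⟩ := exists_headPlane
  obtain ⟨Q, hQ⟩ := exists_tailPlane
  set δ := min δ₁ δ₂ with hδdef
  have hδ : 0 < δ := lt_min hδ₁ hδ₂
  have hδ1 : δ ≤ 1 := (min_le_left _ _).trans hδ₁1
  have hC0 : 0 < C := by linarith
  set l := 16 * C ^ 4 / δ ^ 2 with hldef
  have hlδ : 16 * C ^ 4 ≤ l * δ ^ 2 := by rw [hldef, div_mul_cancel₀]; positivity
  have hl2 : 2 ≤ l := by
    rw [hldef, le_div_iff₀ (by positivity)]
    have h1 : 1 ≤ C ^ 4 := one_le_pow₀ hC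
    have h2 : δ ^ 2 ≤ 1 := pow_le_one₀ hδ.le hδ1
    linarith
  have hl0 : l ≠ 0 := by linarith
  set ε := δ / (2 * C) with hεdef
  have hε : 0 < ε := by positivity
  -- The perturbed frames must stay within ρ, for the crossing to exist, and within ε, for their
  -- planes to lie in the cones.
  set r := min ρ ε with hrdef
  have hr : 0 < r := lt_min hρ hε
  -- Block diagonalisation moves a frame by at most 2κC ≤ r/2.
  set κ := min 1 (r / (4 * C)) with hκdef
  have hκ : 0 < κ := lt_min one_pos (by positivity)
  have hκr : C * (2 * κ) < r := by
    have : κ ≤ r / (4 * C) := min_le_right _ _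
    rw [le_div_iff₀ (by positivity)] at this
    nlinarith
  -- The tolerance 1/2 serves the cone estimates, and κ/8 the graph transform.
  refine ⟨l, hl0, min (1 / 2) (κ / 8), lt_min (by norm_num) (by positivity), fun B hB => ?_⟩
  have hB₁ : ∀ t, ‖((framePath t)⁻¹ * B t * framePath t : GL (Fin 4) ℝ).val -
      (l • headProj + l⁻¹ • tailProj)‖ ≤ 1 / 2 := fun t =>
    (hB t).1.le.trans (min_le_left _ _)
  have hB₁' : ∀ t, ‖((framePath t)⁻¹ * B t * framePath t : GL (Fin 4) ℝ).val -
      (l • headProj + l⁻¹ • tailProj)‖ ≤ κ / 8 := fun t =>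
    (hB t).1.le.trans (min_le_right _ _)
  have hB₂ : ∀ t, ‖((framePath t)⁻¹ * B⁻¹ t * framePath t : GL (Fin 4) ℝ).val -
      (l • tailProj + l⁻¹ • headProj)‖ ≤ 1 / 2 := by
    intro t
    have h1 : (framePath t)⁻¹ * B⁻¹ t * framePath t =
        ((framePath t)⁻¹ * B t * framePath t)⁻¹ := by
      rw [ContinuousMap.inv_apply]; group
    rw [h1]
    exact (hB t).2.le.trans (min_le_left _ _)
  have hexp₁ : ExpandsCone (Set.range B) (approxCone framePath (matAct headProj) ε) :=
    expandsCone_of_norm_sub_le headProj_mul_self norm_headProj_le norm_tailProj_le hC hg hg' hδ hδ1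
      (fun s t y hy => (mul_le_mul_of_nonneg_right (min_le_left _ _) (norm_nonneg _)).trans
        (htr₁ s t y hy)) hlδ hB₁
  have hexp₂ : ExpandsCone (Set.range B)⁻¹ (approxCone framePath (matAct tailProj) ε) := by
    rw [Set.inv_range]
    exact expandsCone_of_norm_sub_le tailProj_mul_self norm_tailProj_le norm_headProj_le hC hg hg'
      hδ hδ1 (fun s t y hy => (mul_le_mul_of_nonneg_right (min_le_right _ _) (norm_nonneg _)).trans
        (htr₂ s t y hy)) hlδ hB₂
  obtain ⟨h₀, X₀, Y₀, hh₀, hX₀, hY₀⟩ := exists_conj_block (hg 0) hl2 hκ.le (min_le_left _ _) (hB₁' 0)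
  obtain ⟨h₁, X₁, Y₁, hh₁, hX₁, hY₁⟩ := exists_conj_block (hg 1) hl2 hκ.le (min_le_left _ _) (hB₁' 1)
  replace hh₀ := hh₀.trans_lt hκr
  replace hh₁ := hh₁.trans_lt hκr
  have hdist : dist (h₀, h₁) (frameMat 0, frameMat 1) < ρ := by
    rw [Prod.dist_eq, dist_eq_norm, dist_eq_norm]
    exact max_lt (hh₀.trans_le (min_le_left _ _)) (hh₁.trans_le (min_le_left _ _))
  obtain ⟨hd₀, hd₁, μ, hμ, x, x', y, y', hx, hx', hy, hy', hy0, hc₀, hc₁⟩ := hball hdist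
  let k₀ : GL (Fin 4) ℝ := Matrix.GeneralLinearGroup.mkOfDetNeZero h₀ hd₀
  let k₁ : GL (Fin 4) ℝ := Matrix.GeneralLinearGroup.mkOfDetNeZero h₁ hd₁
  have hE₀ := mem_approxCone_of_mem_glMap hP (h := k₀) (hh₀.le.trans (min_le_right _ _))
  have hE₁ := mem_approxCone_of_mem_glMap hP (h := k₁) (hh₁.le.trans (min_le_right _ _))
  have hF₀ := mem_approxCone_of_mem_glMap hQ (h := k₀) (hh₀.le.trans (min_le_right _ _))
  have hF₁ := mem_approxCone_of_mem_glMap hQ (h := k₁) (hh₁.le.trans (min_le_right _ _))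
  have hmF₀ : glMap (B 0) (glMap k₀ Q) = glMap k₀ Q := glMap_eq_of_mul_eq tailProj_mul_self hQ hY₀
  have hd₀₀ := isCompl_of_expandsCone hexp₁ hexp₂ rfl hE₀ hF₀ ⟨0, rfl⟩ hmF₀
  have hd₁₀ := isCompl_of_expandsCone hexp₁ hexp₂ rfl hE₁ hF₀ ⟨0, rfl⟩ hmF₀
  have ha : matAct h₀ x ∈ (glMap k₀ P).1 := apply_mem_glMap k₀ ((hP x).2 hx)
  have hb : matAct h₁ x' ∈ (glMap k₁ P).1 := apply_mem_glMap k₁ ((hP x').2 hx')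
  have hab : matAct h₀ x + matAct h₁ x' ∈ (glMap k₀ Q).1 := by
    rw [hc₀]
    exact apply_mem_glMap k₀ ((hQ y).2 hy)
  have hab0 : matAct h₀ x + matAct h₁ x' ≠ 0 := by
    rw [hc₀]
    exact fun h => hy0 ((glEquiv k₀).map_eq_zero_iff.1 h)
  refine ⟨_, _, glMap k₀ P, glMap k₁ P, glMap k₀ Q, glMap k₁ Q, hexp₁, hexp₂,
    glMap_eq_of_mul_eq headProj_mul_self hP hX₀, glMap_eq_of_mul_eq headProj_mul_self hP hX₁,
    hmF₀, glMap_eq_of_mul_eq tailProj_mul_self hQ hY₁, hE₀, hE₁, hF₀, hF₁,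
    _, ha, _, hb, μ, hμ, ?_, hab, ?_⟩
  -- Dependence would put the non-zero vector a + b of F₀ into E₀ (if b = 0) or into E₁ (if a is a
  -- multiple of b). Both planes are transverse to F₀.
  · generalize matAct h₀ x = a at *
    generalize matAct h₁ x' = b at *
    have hb0 : b ≠ 0 := by
      rintro rfl
      rw [add_zero] at hab hab0
      exact hab0 (Submodule.disjoint_def.1 hd₀₀.disjoint _ ha hab)
    rw [LinearIndependent.pair_iff]
    intro s t hst
    have hs : s = 0 := by
      by_contra hs
      have h1 : a = (-(s⁻¹ * t)) • b := by
        rw [neg_smul, mul_smul, ← smul_neg, eq_inv_smul_iff₀ hs]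
        exact eq_neg_of_add_eq_zero_left hst
      refine hab0 (Submodule.disjoint_def.1 hd₁₀.disjoint _ ?_ hab)
      rw [h1]
      exact Submodule.add_mem _ (Submodule.smul_mem _ _ hb) hb
    subst hs
    rw [zero_smul, zero_add] at hst
    exact ⟨rfl, (smul_eq_zero.1 hst).resolve_right hb0⟩
  · rw [hc₁]
    exact apply_mem_glMap k₁ ((hQ y').2 hy')

theorem eventually_norm_conj_sub_lt (g : C(unitInterval, GL (Fin 4) ℝ)) (D : GL (Fin 4) ℝ) {η : ℝ}
    (hη : 0 < η) :
    ∀ᶠ B : C(unitInterval, GL (Fin 4) ℝ) in 𝓝 (g * ContinuousMap.const unitInterval D * g⁻¹),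
      ∀ t, ‖((g t)⁻¹ * B t * g t : GL (Fin 4) ℝ).val - D.val‖ < η ∧
        ‖((g t)⁻¹ * B t * g t : GL (Fin 4) ℝ)⁻¹.val - D⁻¹.val‖ < η := by
  -- Closeness of the inverses is imposed as well, since the stable cone needs it. Compactness of
  -- the interval makes the condition open in the space of paths.
  let V : Set (GL (Fin 4) ℝ) := {M | ‖M.val - D.val‖ < η ∧ ‖M⁻¹.val - D⁻¹.val‖ < η}
  have hV : IsOpen V := by
    refine IsOpen.and (isOpen_lt ?_ continuous_const) (isOpen_lt ?_ continuous_const)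
    · exact (Units.continuous_val.sub continuous_const).norm
    · exact ((Units.continuous_val.comp continuous_inv).sub continuous_const).norm
  have hO := ContinuousMap.isOpen_setOfPred_mapsTo (X := unitInterval) isCompact_univ hV
  have hcont : Continuous fun B : C(unitInterval, GL (Fin 4) ℝ) => g⁻¹ * B * g := by fun_prop
  have hmem : ∀ t, (g⁻¹ * (g * ContinuousMap.const unitInterval D * g⁻¹) * g) t ∈ V := by
    intro t
    have : (g⁻¹ * (g * ContinuousMap.const unitInterval D * g⁻¹) * g) t = D := by
      simp only [ContinuousMap.mul_apply, ContinuousMap.inv_apply, ContinuousMap.const_apply]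
      group
    rw [this]
    simpa [V] using hη
  filter_upwards [(hO.preimage hcont).mem_nhds fun t _ => hmem t] with B hB t
  exact hB (Set.mem_univ t)

end Perturbation

end

theorem theorem3 :
    ∃ A : C(unitInterval, GL (Fin 4) ℝ),
      DominatedNoSemiconvexMulticone 2 (Set.range A) ∧
      ∀ᶠ B : C(unitInterval, GL (Fin 4) ℝ) in 𝓝 A,
        DominatedNoSemiconvexMulticone 2 (Set.range B) := by
  obtain ⟨l, hl, η, hη, hmain⟩ := exists_hasCrossing
  have hev : ∀ᶠ B : C(unitInterval, GL (Fin 4) ℝ) in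
      𝓝 (framePath * ContinuousMap.const _ (hyperbolicDiag l hl) * framePath⁻¹),
      DominatedNoSemiconvexMulticone 2 (Set.range B) := by
    filter_upwards [eventually_norm_conj_sub_lt framePath (hyperbolicDiag l hl) hη] with B hB
    obtain ⟨U, U', E₀, E₁, F₀, F₁, h⟩ := hmain B hB
    exact h.dominatedNoSemiconvexMulticone
  exact ⟨_, hev.self_of_nhds, hev⟩
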